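/- **Conventions.** A Banach analytic manifold is a Hausdorff space with an analytic atlas modelled on a complex Banach space. For Banach analytic manifolds $A,X$, $\mathrm{Hol}(A,X)$ is the set of holomorphic maps $A\to X$ with the compact-open topology, and for a sequence $\{f_k\}\subset\mathrm{Hol}(A,X)$ we let $Z_{\{f_k\}}$ be the set of $\lambda\in A$ such that $\{f_k(\lambda)\}$ converges in $X$. For $S\subset A$, $S^u$ is the set of $z\in A\cap\overline S$ such that for every connected open neighbourhood $U$ of $z$ and every holomorphic $g:U\to\mathbb C$, $g|_{U\cap S}=0$ implies $g|_U=0$. * $X$ has the *strong Vitali property* (SVP) if for every connected Banach analytic manifold $A$, every sequence $\{f_k\}\subset\mathrm{Hol}(A,X)$ with $Z^u_{\{f_k\}}\neq\emptyset$ converges in $\mathrm{Hol}(A,X)$. * An open subset $U$ of $X$ has the *quasi strong Vitali property* (QSVP) if for every connected Banach analytic manifold $A$, every sequence $\{f_k\}\subset\mathrm{Hol}(A,X)$ with $f_k(A)\subset U$ for all $k$ and $Z^u_{\{f_k\}}\ne\emptyset$ converges in $\mathrm{Hol}(A,X)$ (here $Z_{\{f_k\}}$, too, refers to convergence in $X$).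 * $X$ is *hyperbolic* if its Kobayashi pseudo-distance $\kappa_X$ (the infimum of the lengths, for the Poincaré distance, of chains of holomorphic discs joining two points; $+\infty$ if there is no such chain) satisfies $\kappa_X(p,q)=0\Rightarrow p=q$ and defines the topology of $X$. * A function $\varphi:\Omega\to[-\infty,\infty)$ on an open subset $\Omega$ of a complex Banach space is *plurisubharmonic* if it is upper semicontinuous and its restriction to the intersection of $\Omega$ with each complex line is subharmonic (the function $\equiv-\infty$ being allowed). **Theorem 4.4.** Let $\Omega$ be an open subset of a complex Banach space $X$. Assume that $\varphi$ is a negative plurisubharmonic function on $\Omega$ such that $$\lim_{z\to\xi,\ z\in\Omega}\varphi(z)=0\qquad\text{for all }\xi\in\partial\Omega .$$ Then the following assertions are equivalent: (i) $\Omega$ is hyperbolic, and for every real $c<0$ the open subset $\Omega_c:=\{z\in\Omega:\varphi(z)<c\}$ of $X$ has QSVP. (ii) $\Omega$ has SVP. -/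

import Mathlib

open scoped Manifold ContDiff Topology ENNReal MeasureTheory
open Filter TopologicalSpace Set MeasureTheory

universe v u w

noncomputable section

/-- `Hol E A F X`: the holomorphic maps from `A` to `X`, where `A` and `X` are modelled on the
complex normed spaces `E` and `F`. Being a subtype of `C(A, X)`, it carries the compact-open
topology. -/
abbrev Hol (E : Type*) [NormedAddCommGroup E] [NormedSpace ℂ E]
    (A : Type*) [TopologicalSpace A] [ChartedSpace E A]
    (F : Type*) [NormedAddCommGroup F] [NormedSpace ℂ F]
    (X : Type*) [TopologicalSpace X] [ChartedSpace F X] : Type _ :=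
  {f : C(A, X) // MDifferentiable 𝓘(ℂ, E) 𝓘(ℂ, F) f}

/-- The sequence `f` converges in `Hol(A, X)` for the compact-open topology. -/
def HolConverges {E : Type*} [NormedAddCommGroup E] [NormedSpace ℂ E]
    {A : Type*} [TopologicalSpace A] [ChartedSpace E A]
    {F : Type*} [NormedAddCommGroup F] [NormedSpace ℂ F]
    {X : Type*} [TopologicalSpace X] [ChartedSpace F X] (f : ℕ → Hol E A F X) : Prop :=
  ∃ g : Hol E A F X, Tendsto f atTop (𝓝 g)

/-- `Z_{f_k}`: the points at which the sequence `f` converges in the target `X`. -/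
def convSet {E : Type*} [NormedAddCommGroup E] [NormedSpace ℂ E]
    {A : Type*} [TopologicalSpace A] [ChartedSpace E A]
    {F : Type*} [NormedAddCommGroup F] [NormedSpace ℂ F]
    {X : Type*} [TopologicalSpace X] [ChartedSpace F X] (f : ℕ → Hol E A F X) : Set A :=
  {a | ∃ x : X, Tendsto (fun k => (f k).1 a) atTop (𝓝 x)}

/-- `S^u`: the points `z` of the closure of `S` such that, on each connected open neighbourhood `U`
of `z`, a holomorphic function on `U` that vanishes on `U ∩ S` vanishes on `U`. (The values of `g`
outside the open set `U` play no role.) -/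
def uniquenessSet (E : Type*) [NormedAddCommGroup E] [NormedSpace ℂ E]
    {A : Type*} [TopologicalSpace A] [ChartedSpace E A] (S : Set A) : Set A :=
  {z | z ∈ closure S ∧ ∀ U : Set A, IsOpen U → IsConnected U → z ∈ U →
    ∀ g : A → ℂ, MDifferentiableOn 𝓘(ℂ, E) 𝓘(ℂ, ℂ) g U →
      (∀ a ∈ U ∩ S, g a = 0) → ∀ a ∈ U, g a = 0}

/-- The strong Vitali property. The sources are the connected (Hausdorff) manifolds `A` modelled on
complex Banach spaces `E`, with analytic transition maps. -/
def HasSVP (F : Type u) [NormedAddCommGroup F] [NormedSpace ℂ F]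
    (X : Type w) [TopologicalSpace X] [ChartedSpace F X] : Prop :=
  ∀ (E : Type v) [NormedAddCommGroup E] [NormedSpace ℂ E] [CompleteSpace E]
    (A : Type v) [TopologicalSpace A] [T2Space A] [ConnectedSpace A] [ChartedSpace E A]
    [IsManifold 𝓘(ℂ, E) ω A] (f : ℕ → Hol E A F X),
    (uniquenessSet E (convSet f)).Nonempty → HolConverges f

/-- The quasi strong Vitali property of an open subset `U` of the manifold `X`. A holomorphic map
from `A` to `U` is a holomorphic map from `A` to `X` with values in `U`; convergence, at points and
in `Hol(A, X)`, is convergence in the ambient manifold `X`. -/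
def HasQSVP (F : Type u) [NormedAddCommGroup F] [NormedSpace ℂ F]
    {X : Type w} [TopologicalSpace X] [ChartedSpace F X] (U : Set X) : Prop :=
  ∀ (E : Type v) [NormedAddCommGroup E] [NormedSpace ℂ E] [CompleteSpace E]
    (A : Type v) [TopologicalSpace A] [T2Space A] [ConnectedSpace A] [ChartedSpace E A]
    [IsManifold 𝓘(ℂ, E) ω A] (f : ℕ → Hol E A F X),
    (∀ k a, (f k).1 a ∈ U) → (uniquenessSet E (convSet f)).Nonempty → HolConverges f

/-- The open unit disc `Δ` of the complex plane. -/
def unitDisc : Opens ℂ := ⟨Metric.ball 0 1, Metric.isOpen_ball⟩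

/-- The Poincaré distance of the unit disc. -/
def poincareDist (a b : unitDisc) : ℝ :=
  Real.artanh (‖(a : ℂ) - b‖ / ‖1 - (starRingEnd ℂ) (a : ℂ) * b‖)

/-- A holomorphic chain of discs in `X` from `p` to `q`, with `n` links. -/
structure HolChain (F : Type*) [NormedAddCommGroup F] [NormedSpace ℂ F]
    {X : Type*} [TopologicalSpace X] [ChartedSpace F X] (p q : X) where
  n : ℕ
  pt : Fin (n + 1) → X
  a : Fin n → unitDisc
  b : Fin n → unitDisc
  f : Fin n → Hol ℂ unitDisc F X
  map_a : ∀ i, (f i).1 (a i) = pt i.castSucc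
  map_b : ∀ i, (f i).1 (b i) = pt i.succ
  pt_zero : pt 0 = p
  pt_last : pt (Fin.last n) = q

/-- The length of a holomorphic chain: the sum of the Poincaré distances of its links. -/
def HolChain.length {F : Type*} [NormedAddCommGroup F] [NormedSpace ℂ F]
    {X : Type*} [TopologicalSpace X] [ChartedSpace F X] {p q : X} (α : HolChain F p q) : ℝ :=
  ∑ i, poincareDist (α.a i) (α.b i)

/-- The Kobayashi pseudo-distance; it is `∞` between points that no holomorphic chain joins, that
is, between points of different connected components. -/
def kobayashi (F : Type*) [NormedAddCommGroup F] [NormedSpace ℂ F]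
    {X : Type*} [TopologicalSpace X] [ChartedSpace F X] (p q : X) : ℝ≥0∞ :=
  ⨅ α : HolChain F p q, ENNReal.ofReal α.length

/-- `X` is hyperbolic: the Kobayashi pseudo-distance is a distance and defines the topology of
`X`. -/
def IsHyperbolic (F : Type*) [NormedAddCommGroup F] [NormedSpace ℂ F]
    (X : Type*) [TopologicalSpace X] [ChartedSpace F X] : Prop :=
  (∀ p q : X, kobayashi F p q = 0 → p = q) ∧
  ∀ S : Set X, IsOpen S ↔
    ∀ p ∈ S, ∃ ε : ℝ≥0∞, 0 < ε ∧ ∀ q, kobayashi F p q < ε → q ∈ S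

/-- The mean value over `[0, 2π]` of a function with values in `[-∞, ∞]`: the mean of the positive
part minus the mean of the negative part (meaningful when the first of these is finite). -/
def circleMean (u : ℝ → EReal) : EReal :=
  ((⨍⁻ θ in Ioc 0 (2 * Real.pi), (u θ).toENNReal ∂volume : ℝ≥0∞) : EReal) -
    ((⨍⁻ θ in Ioc 0 (2 * Real.pi), (-u θ).toENNReal ∂volume : ℝ≥0∞) : EReal)

/-- `φ : Ω → [-∞, ∞)` is plurisubharmonic on the open set `Ω` of a complex Banach space: it is
upper semicontinuous, and on each complex line it satisfies the sub-mean value inequality for all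
closed discs contained in `Ω`. The function that is identically `-∞` is allowed. -/
structure IsPlurisubharmonicOn {X : Type*} [NormedAddCommGroup X] [NormedSpace ℂ X]
    (φ : X → EReal) (Ω : Set X) : Prop where
  lt_top : ∀ z ∈ Ω, φ z < ⊤
  usc : UpperSemicontinuousOn φ Ω
  submean : ∀ a b : X, (∀ ζ : ℂ, ‖ζ‖ ≤ 1 → a + ζ • b ∈ Ω) →
    φ a ≤ circleMean fun θ => φ (a + Complex.exp (θ * Complex.I) • b)

end

noncomputable section

/-! ### Holomorphic maps into and out of open subsets, and their compact-open limits -/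

section Opens

variable {E : Type*} [NormedAddCommGroup E] [NormedSpace ℂ E]
  {A : Type*} [TopologicalSpace A] [ChartedSpace E A]
  {F : Type*} [NormedAddCommGroup F] [NormedSpace ℂ F]
  {X : Type*} [TopologicalSpace X] [ChartedSpace F X]

/-! SVP gives (i). If hyperbolicity failed at `p`, there would be discs `F k` with centres tending
to `p` and points `z k → 0` with `F k (z k)` far from `p`. Composed with the `k`-th coordinate, they
become maps on the unit ball of ℓ² that converge to `p` on the dense set of finitely supported
vectors, hence converge by SVP; uniformity on the compact set formed by `0` and the vectors `z k •
e_k` is a contradiction (`HasSVP.exists_disc_bound`). The Schwarz lemma then controls each short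
link of a Kobayashi chain. QSVP of a sublevel set follows because a limit of points with `φ < c < 0`
cannot lie on the boundary, where `φ` tends to 0.

Conversely, let `a` be a uniqueness point of the convergence set. Some point near `a` has images
converging to some `q` in `Ω`. Hyperbolicity makes the maps equicontinuous there, so they send a
small ball into one sublevel set. A two-constants estimate, uniform in the maps, propagates a bound
`φ < c' < 0` to a ball containing `a`, where QSVP applies (`exists_local_limit`). Hence uniqueness
points are interior to the convergence set; by the identity theorem that interior is closed, so it
is everything.

The two-constants estimate must be drawn from a definition of plurisubharmonicity that sees complex
lines only. Curved discs are treated by a penalized maximum principle in a tube around the disc,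
moving along tangent lines. The squared penalty needs a Hilbert norm, so a Banach disc is first
factored through ℓ² (`exists_factor_hilbert`). -/

theorem mdifferentiableAt_comp_subtypeVal_iff {U : Opens A} {f : A → X} {x : U} :
    MDifferentiableAt 𝓘(ℂ, E) 𝓘(ℂ, F) (fun y : U => f y) x ↔
      MDifferentiableAt 𝓘(ℂ, E) 𝓘(ℂ, F) f x :=
  ((differentiableWithinAt_localInvariantProp (I := 𝓘(ℂ, E))
    (I' := 𝓘(ℂ, F))).liftPropAt_iff_comp_subtype_val f x).symm

theorem mdifferentiableAt_subtypeVal_comp_iff {U : Opens X} {f : A → U} {x : A} :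
    MDifferentiableAt 𝓘(ℂ, E) 𝓘(ℂ, F) (fun y => (f y : X)) x ↔
      MDifferentiableAt 𝓘(ℂ, E) 𝓘(ℂ, F) f x := by
  have := ChartedSpace.liftPropWithinAt_subtypeVal_comp_iff (H := E) (H' := F)
    (P := DifferentiableWithinAtProp 𝓘(ℂ, E) 𝓘(ℂ, F)) f Set.univ x
  rw [← mdifferentiableWithinAt_univ, ← mdifferentiableWithinAt_univ]
  exact this

/-- Corestriction of a holomorphic map to an open set. -/
def Hol.codRestrict {U : Opens X} (f : Hol E A F X) (h : ∀ a, f.1 a ∈ U) : Hol E A F U :=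
  ⟨⟨fun a => ⟨f.1 a, h a⟩, f.1.continuous.subtype_mk h⟩,
    fun a => mdifferentiableAt_subtypeVal_comp_iff.1 (f.2 a)⟩

/-- A holomorphic map into an open set, as a map into the ambient manifold. -/
def Hol.toAmbient {U : Opens X} (f : Hol E A F U) : Hol E A F X :=
  ⟨⟨fun a => (f.1 a : X), continuous_subtype_val.comp f.1.continuous⟩,
    fun a => mdifferentiableAt_subtypeVal_comp_iff.2 (f.2 a)⟩

/-- Restriction of a holomorphic map to an open set. -/
def Hol.restrict (B : Opens A) (f : Hol E A F X) : Hol E B F X :=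
  ⟨⟨fun a => f.1 a, f.1.continuous.comp continuous_subtype_val⟩,
    fun a => mdifferentiableAt_comp_subtypeVal_iff.2 (f.2 a)⟩

theorem tendsto_hol_iff {ι : Type*} {l : Filter ι} {f : ι → Hol E A F X} {g : Hol E A F X} :
    Tendsto f l (𝓝 g) ↔ ∀ K : Set A, IsCompact K → ∀ U : Set X, IsOpen U → MapsTo g.1 K U →
      ∀ᶠ k in l, MapsTo (f k).1 K U := by
  rw [tendsto_subtype_rng, ContinuousMap.tendsto_nhds_compactOpen]

theorem tendsto_apply_of_tendsto_hol {ι : Type*} {l : Filter ι} {f : ι → Hol E A F X}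
    {g : Hol E A F X} (h : Tendsto f l (𝓝 g)) (a : A) :
    Tendsto (fun k => (f k).1 a) l (𝓝 (g.1 a)) := by
  refine tendsto_nhds.2 fun U hU ha => ?_
  filter_upwards [tendsto_hol_iff.1 h {a} isCompact_singleton U hU (by simpa using ha)] with k hk
  exact hk rfl

end Opens

section VectorSpace

variable {E : Type*} [NormedAddCommGroup E] [NormedSpace ℂ E]
  {F : Type*} [NormedAddCommGroup F] [NormedSpace ℂ F]

/-- A holomorphic map between open subsets of normed spaces, given by a function on the ambient
space. -/
def holOfDifferentiableOn {U : Opens E} {Ω : Opens F} (f : E → F)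
    (hf : DifferentiableOn ℂ f U) (hm : MapsTo f U Ω) : Hol E U F Ω :=
  ⟨⟨fun a => ⟨f a, hm a.2⟩, hf.continuousOn.domRestrict.subtype_mk _⟩, fun a =>
    mdifferentiableAt_subtypeVal_comp_iff.1 <| mdifferentiableAt_comp_subtypeVal_iff.2 <|
      mdifferentiableAt_iff_differentiableAt.2 (hf.differentiableAt (U.2.mem_nhds a.2))⟩

theorem Hol.exists_differentiableOn {U : Opens E} {Ω : Opens F} (f : Hol E U F Ω) :
    ∃ g : E → F, DifferentiableOn ℂ g U ∧ ∀ a : U, g a = f.1 a := by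
  classical
  refine ⟨fun a => if h : a ∈ U then f.1 ⟨a, h⟩ else 0, fun a ha => ?_, fun a => by simp⟩
  refine (mdifferentiableAt_iff_differentiableAt.1 ?_).differentiableWithinAt
  refine (mdifferentiableAt_comp_subtypeVal_iff (x := (⟨a, ha⟩ : U))).1 ?_
  have : (fun y : U => if h : (y : E) ∈ U then (f.1 ⟨y, h⟩ : F) else 0) = fun y => (f.1 y : F) := by
    ext y; simp
  rw [this]
  exact mdifferentiableAt_subtypeVal_comp_iff.2 (f.2 _)

end VectorSpace

section Charts

variable {E : Type*} [NormedAddCommGroup E] [NormedSpace ℂ E]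
  {A : Type*} [TopologicalSpace A] [ChartedSpace E A] [IsManifold 𝓘(ℂ, E) ω A]
  {F : Type*} [NormedAddCommGroup F] [NormedSpace ℂ F]

theorem MDifferentiableOn.differentiableOn_comp_chartAt_symm {f : A → F} {U : Set A}
    (hf : MDifferentiableOn 𝓘(ℂ, E) 𝓘(ℂ, F) f U) (a : A) :
    DifferentiableOn ℂ (f ∘ (chartAt E a).symm)
      ((chartAt E a).target ∩ (chartAt E a).symm ⁻¹' U) := by
  have h : MDifferentiableOn 𝓘(ℂ, E) 𝓘(ℂ, E) (chartAt E a).symm (chartAt E a).target :=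
    (contMDiffOn_chart_symm (n := ω)).mdifferentiableOn (by simp)
  exact mdifferentiableOn_iff_differentiableOn.1
    (hf.comp (h.mono inter_subset_left) fun x hx => hx.2)

end Charts
end

noncomputable section

/-! ### Sub-mean value inequality and the tangent-line step -/

section Plurisubharmonic

theorem circleMean_le_intervalAverage {u : ℝ → EReal} {T : ℝ → ℝ} (hT : Continuous T)
    (h : ∀ θ, u θ ≤ T θ) :
    circleMean u ≤ ((⨍ θ in Ioc 0 (2 * Real.pi), T θ : ℝ) : EReal) := by
  set ν : Measure ℝ := (volume.restrict (Ioc 0 (2 * Real.pi)) univ)⁻¹ •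
    volume.restrict (Ioc 0 (2 * Real.pi)) with hν
  have hint : Integrable T ν := by
    have h1 : Integrable T (volume.restrict (Ioc 0 (2 * Real.pi))) :=
      (hT.continuousOn.integrableOn_compact isCompact_Icc).mono_set Ioc_subset_Icc_self
    refine h1.smul_measure ?_
    simp [Real.pi_pos]
  have hpos : (∫⁻ θ, ENNReal.ofReal (T θ) ∂ν) ≠ ⊤ := hint.lintegral_lt_top.ne
  have hneg : (∫⁻ θ, ENNReal.ofReal (-T θ) ∂ν) ≠ ⊤ := hint.neg.lintegral_lt_top.ne
  have h1 : (∫⁻ θ, (u θ).toENNReal ∂ν) ≤ ∫⁻ θ, ENNReal.ofReal (T θ) ∂ν := by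
    refine lintegral_mono fun θ => ?_
    have : ENNReal.ofReal (T θ) = (T θ : EReal).toENNReal := by
      rw [EReal.toENNReal_of_ne_top (EReal.coe_ne_top _), EReal.toReal_coe]
    rw [this]
    exact EReal.toENNReal_le_toENNReal (h θ)
  have h2 : (∫⁻ θ, ENNReal.ofReal (-T θ) ∂ν) ≤ ∫⁻ θ, (-u θ).toENNReal ∂ν := by
    refine lintegral_mono fun θ => ?_
    have : ENNReal.ofReal (-T θ) = ((-T θ : ℝ) : EReal).toENNReal := by
      rw [EReal.toENNReal_of_ne_top (EReal.coe_ne_top _), EReal.toReal_coe]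
    rw [this]
    refine EReal.toENNReal_le_toENNReal ?_
    rw [EReal.coe_neg, EReal.neg_le_neg_iff]
    exact h θ
  have h3 : (⨍ θ in Ioc 0 (2 * Real.pi), T θ : ℝ) = (∫⁻ θ, ENNReal.ofReal (T θ) ∂ν).toReal -
      (∫⁻ θ, ENNReal.ofReal (-T θ) ∂ν).toReal :=
    integral_eq_lintegral_pos_part_sub_lintegral_neg_part hint
  rw [h3, EReal.coe_sub, EReal.coe_ennreal_toReal hpos, EReal.coe_ennreal_toReal hneg]
  exact EReal.sub_le_sub (EReal.coe_ennreal_le_coe_ennreal_iff.2 h1)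
    (EReal.coe_ennreal_le_coe_ennreal_iff.2 h2)

/-- A plurisubharmonic function that is dominated on a circle by the real part of a holomorphic
function is dominated by it at the centre. -/
theorem IsPlurisubharmonicOn.le_re_of_le_on_circle {X : Type*} [NormedAddCommGroup X]
    [NormedSpace ℂ X] {φ : X → EReal} {Ω : Set X} (hφ : IsPlurisubharmonicOn φ Ω) {a b : X}
    (hab : ∀ ζ : ℂ, ‖ζ‖ ≤ 1 → a + ζ • b ∈ Ω) {k : ℂ → ℂ}
    (hk : DifferentiableOn ℂ k (Metric.closedBall 0 1)) {C : ℝ}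
    (h : ∀ ζ : ℂ, ‖ζ‖ = 1 → φ (a + ζ • b) ≤ ((C + (k ζ).re : ℝ) : EReal)) :
    φ a ≤ ((C + (k 0).re : ℝ) : EReal) := by
  have hexp : ∀ θ : ℝ, ‖Complex.exp (θ * Complex.I)‖ = 1 := Complex.norm_exp_ofReal_mul_I
  have hcont : Continuous fun θ : ℝ => k (Complex.exp (θ * Complex.I)) := by
    refine hk.continuousOn.comp_continuous (by fun_prop) fun θ => ?_
    simp [hexp]
  refine (hφ.submean a b hab).trans ((circleMean_le_intervalAverage
    (T := fun θ => C + (k (Complex.exp (θ * Complex.I))).re) 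
    (continuous_const.add (Complex.continuous_re.comp hcont)) fun θ => h _ (hexp θ)).trans ?_)
  rw [EReal.coe_le_coe_iff]
  have hd : DiffContOnCl ℂ (fun ζ => C + k ζ) (Metric.ball 0 |1|) := by
    refine DifferentiableOn.diffContOnCl ?_
    rw [abs_one, closure_ball _ one_ne_zero]
    exact hk.const_add _
  have hav := hd.circleAverage
  rw [Real.circleAverage_eq_intervalAverage, uIoc_of_le (by positivity)] at hav
  have := congrArg Complex.re hav
  rw [average_eq, ← RCLike.re_eq_complex_re, RCLike.smul_re, ← integral_re] at this
  · rw [average_eq]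
    simp only [circleMap_zero, Complex.ofReal_one, one_mul] at this
    simpa using this.le
  · have : Continuous fun θ : ℝ => (C : ℂ) + k (circleMap 0 1 θ) := by
      refine continuous_const.add ?_
      simpa only [circleMap_zero, Complex.ofReal_one, one_mul] using hcont
    exact (this.continuousOn.integrableOn_compact isCompact_Icc).mono_set Ioc_subset_Icc_self

/-- Mean value inequality for `G z - z • deriv G ζ` on a convex set, with `η` from the uniform
continuity of `deriv G` on the compact disc. -/
theorem exists_uniform_differentiable_of_isCompact {H : Type*} [NormedAddCommGroup H]
    [NormedSpace ℂ H] [CompleteSpace H] {G : ℂ → H} {s R : ℝ} (hR : R < s)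
    (hG : DifferentiableOn ℂ G (Metric.ball 0 s)) {η : ℝ} (hη : 0 < η) :
    ∃ ε > 0, ∀ ζ h : ℂ, ‖ζ‖ ≤ R → ‖ζ + h‖ ≤ R → ‖h‖ < ε →
      ‖G (ζ + h) - G ζ - h • deriv G ζ‖ ≤ η * ‖h‖ := by
  have hsub : Metric.closedBall (0 : ℂ) R ⊆ Metric.ball 0 s := Metric.closedBall_subset_ball hR
  have hu : UniformContinuousOn (deriv G) (Metric.closedBall 0 R) :=
    (isCompact_closedBall _ _).uniformContinuousOn_of_continuous
      ((hG.deriv Metric.isOpen_ball).continuousOn.mono hsub)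
  obtain ⟨ε, hε, H⟩ := Metric.uniformContinuousOn_iff.1 hu η hη
  refine ⟨ε, hε, fun ζ h hζ hζh hh => ?_⟩
  have hconv : Convex ℝ (Metric.closedBall (0 : ℂ) R ∩ Metric.ball ζ ε) :=
    (convex_closedBall _ _).inter (convex_ball _ _)
  have hder : ∀ z ∈ Metric.closedBall (0 : ℂ) R ∩ Metric.ball ζ ε,
      HasDerivWithinAt (fun z => G z - z • deriv G ζ) (deriv G z - deriv G ζ)
        (Metric.closedBall (0 : ℂ) R ∩ Metric.ball ζ ε) z := fun z hz => by
    have h1 : HasDerivAt G (deriv G z) z :=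
      (hG.differentiableAt (Metric.isOpen_ball.mem_nhds (hsub hz.1))).hasDerivAt
    have h2 := h1.sub ((hasDerivAt_id z).smul_const (deriv G ζ))
    simp only [one_smul] at h2
    exact h2.hasDerivWithinAt
  have := hconv.norm_image_sub_le_of_norm_hasDerivWithin_le (C := η) hder
    (fun z hz => by
      rw [← dist_eq_norm]
      exact (H z hz.1 ζ (by simpa using hζ) hz.2).le)
    (x := ζ) (y := ζ + h) ⟨by simpa using hζ, by simpa using hε⟩
    ⟨by simpa using hζh, by simpa using hh⟩
  simp only [add_sub_cancel_left] at this
  refine le_trans (le_of_eq ?_) this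
  congr 1
  rw [add_smul]
  abel

variable {H : Type*} [NormedAddCommGroup H] [InnerProductSpace ℂ H]

/-- One step along the tangent of the disc `G`: a penalized upper bound for `φ` improves by a
definite amount of order `ε ^ 2`. -/
theorem IsPlurisubharmonicOn.penalized_le {φ : H → EReal} {Ω : Set H}
    (hφ : IsPlurisubharmonicOn φ Ω) {G : ℂ → H} {ζ : ℂ} {w : H} {ε η A B M R S : ℝ}
    (hA : 0 ≤ A) (hM : 0 ≤ M) (hε : 0 < ε) (hεζ : ε < ‖ζ‖) (hζR : ‖ζ‖ ≤ R)
    (hG : DifferentiableOn ℂ G (Metric.closedBall ζ ε))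
    (hΩ : ∀ z : ℂ, ‖z‖ ≤ 1 → w + z • ((ε : ℂ) • deriv G ζ) ∈ Ω)
    (hζR' : ∀ z : ℂ, ‖z‖ = 1 → ‖ζ + ε * z‖ ≤ R)
    (he : ∀ z : ℂ, ‖z‖ = 1 → ‖G (ζ + ε * z) - G ζ - (ε * z) • deriv G ζ‖ ≤ η * ε)
    (hb : ∀ z : ℂ, ‖z‖ = 1 → φ (w + z • ((ε : ℂ) • deriv G ζ)) ≤
      ((S - A * (‖(ζ + ε * z)⁻¹‖ ^ 2 - B) +
        M * ‖w + z • ((ε : ℂ) • deriv G ζ) - G (ζ + ε * z)‖ ^ 2 : ℝ) : EReal)) :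
    φ w ≤ ((S - A * (‖ζ⁻¹‖ ^ 2 - B) + M * ‖w - G ζ‖ ^ 2 - A * (ε / R ^ 2) ^ 2
      + M * (η * ε) ^ 2 : ℝ) : EReal) := by
  have hζ0 : ζ ≠ 0 := fun h => by simp [h] at hεζ; linarith
  have hR : 0 < R := by linarith
  set d := w - G ζ with hd
  set e : ℂ → H := fun z => G (ζ + ε * z) - G ζ - (ε * z) • deriv G ζ with he_def
  -- Expanding both squares, the cross terms are real parts of functions holomorphic in `z` and
  -- vanishing at 0, so the mean value removes them, even though they may be larger than `ε ^ 2`.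
  -- What remains is a gain from `‖ζ⁻¹‖ ^ 2` and the loss `‖e z‖ ^ 2`.
  set k : ℂ → ℂ := fun z => -2 * A * ((starRingEnd ℂ) ζ⁻¹ * ((ζ + ε * z)⁻¹ - ζ⁻¹))
    - 2 * M * inner ℂ d (e z) with hk_def
  have hne : ∀ z : ℂ, ‖z‖ ≤ 1 → ζ + ε * z ≠ 0 := fun z hz h0 => by
    have : ζ = -(ε * z) := by linear_combination h0
    rw [this, norm_neg, norm_mul, Complex.norm_real, Real.norm_of_nonneg hε.le] at hεζ
    nlinarith
  have hmaps : MapsTo (fun z : ℂ => ζ + ε * z) (Metric.closedBall 0 1)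
      (Metric.closedBall ζ ε) := fun z hz => by
    have hz' : ‖z‖ ≤ 1 := by simpa using hz
    simp only [Metric.mem_closedBall, dist_eq_norm, add_sub_cancel_left, norm_mul,
      Complex.norm_real, Real.norm_of_nonneg hε.le]
    nlinarith
  have hde : DifferentiableOn ℂ e (Metric.closedBall 0 1) := by
    refine DifferentiableOn.sub (DifferentiableOn.sub (hG.comp (by fun_prop) hmaps) (by fun_prop))
      (by fun_prop)
  have hdk : DifferentiableOn ℂ k (Metric.closedBall 0 1) := by
    refine DifferentiableOn.sub (DifferentiableOn.const_mul (DifferentiableOn.const_mul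
      (DifferentiableOn.sub_const (DifferentiableOn.inv (by fun_prop) fun z hz => hne z
        (by simpa using hz)) _) _) _) (DifferentiableOn.const_mul ?_ _)
    exact (innerSL ℂ d).differentiable.comp_differentiableOn hde
  have hk0 : k 0 = 0 := by simp [hk_def, he_def]
  have key := hφ.le_re_of_le_on_circle hΩ hdk (C := S - A * (‖ζ⁻¹‖ ^ 2 - B) + M * ‖d‖ ^ 2
    - A * (ε / R ^ 2) ^ 2 + M * (η * ε) ^ 2) fun z hz => ?_
  · simpa [hk0] using key
  refine (hb z hz).trans ?_
  rw [EReal.coe_le_coe_iff]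
  have h1 : w + z • ((ε : ℂ) • deriv G ζ) - G (ζ + ε * z) = d - e z := by
    simp only [hd, he_def, smul_smul, mul_comm z]
    abel
  have h2 : ‖d - e z‖ ^ 2 = ‖d‖ ^ 2 - 2 * (inner ℂ d (e z)).re + ‖e z‖ ^ 2 :=
    norm_sub_sq (𝕜 := ℂ) d (e z)
  have h3 : ‖(ζ + ε * z)⁻¹‖ ^ 2 = ‖ζ⁻¹‖ ^ 2 +
      2 * ((starRingEnd ℂ) ζ⁻¹ * ((ζ + ε * z)⁻¹ - ζ⁻¹)).re + ‖(ζ + ε * z)⁻¹ - ζ⁻¹‖ ^ 2 := by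
    have := norm_add_sq (𝕜 := ℂ) ζ⁻¹ ((ζ + ε * z)⁻¹ - ζ⁻¹)
    rw [add_sub_cancel, RCLike.inner_apply] at this
    rw [mul_comm ((starRingEnd ℂ) ζ⁻¹)]
    exact this
  have h4 : ε / R ^ 2 ≤ ‖(ζ + ε * z)⁻¹ - ζ⁻¹‖ := by
    have hz0 := hne z hz.le
    have : (ζ + ε * z)⁻¹ - ζ⁻¹ = -(ε * z) / ((ζ + ε * z) * ζ) := by
      field_simp
      ring
    rw [this, norm_div, norm_neg, norm_mul, norm_mul, hz, Complex.norm_real,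
      Real.norm_of_nonneg hε.le, mul_one, sq]
    have := hζR' z hz
    have h5 : 0 < ‖ζ + ε * z‖ := norm_pos_iff.2 hz0
    have h6 : 0 < ‖ζ‖ := norm_pos_iff.2 hζ0
    gcongr
  have h5 : (k z).re = -2 * A * ((starRingEnd ℂ) ζ⁻¹ * ((ζ + ε * z)⁻¹ - ζ⁻¹)).re
      - 2 * M * (inner ℂ d (e z)).re := by
    have : k z = ((-2 * A : ℝ) : ℂ) * ((starRingEnd ℂ) ζ⁻¹ * ((ζ + ε * z)⁻¹ - ζ⁻¹))
      - ((2 * M : ℝ) : ℂ) * inner ℂ d (e z) := by simp [hk_def]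
    rw [this, Complex.sub_re, Complex.re_ofReal_mul, Complex.re_ofReal_mul]
  have h6 : A * (ε / R ^ 2) ^ 2 ≤ A * ‖(ζ + ε * z)⁻¹ - ζ⁻¹‖ ^ 2 := by gcongr
  have h7 : M * ‖e z‖ ^ 2 ≤ M * (η * ε) ^ 2 := by
    have := he z hz
    gcongr
  rw [h1, h2, h3, h5]
  nlinarith [h6, h7]

end Plurisubharmonic
end

noncomputable section

/-! ### The two-constants estimate -/

section TwoConstants

theorem IsPlurisubharmonicOn.isOpen_lt {X : Type*} [NormedAddCommGroup X] [NormedSpace ℂ X]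
    {φ : X → EReal} {Ω : Set X} (hφ : IsPlurisubharmonicOn φ Ω) (hΩ : IsOpen Ω) (c : EReal) :
    IsOpen {z | z ∈ Ω ∧ φ z < c} := by
  refine isOpen_iff_mem_nhds.2 fun z hz => ?_
  have h1 := hφ.usc z hz.1 c hz.2
  rw [hΩ.nhdsWithin_eq hz.1] at h1
  filter_upwards [h1, hΩ.mem_nhds hz.1] with y hy hy' using ⟨hy', hy⟩

theorem IsPlurisubharmonicOn.comp_clm {X Y : Type*} [NormedAddCommGroup X] [NormedSpace ℂ X]
    [NormedAddCommGroup Y] [NormedSpace ℂ Y] {φ : X → EReal} {Ω : Set X}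
    (hφ : IsPlurisubharmonicOn φ Ω) (L : Y →L[ℂ] X) :
    IsPlurisubharmonicOn (φ ∘ L) (L ⁻¹' Ω) where
  lt_top z hz := hφ.lt_top _ hz
  usc z hz y hy := by
    have := (L.continuous.continuousWithinAt (s := L ⁻¹' Ω) (x := z)).tendsto_nhdsWithin
      (mapsTo_preimage L Ω)
    exact this.eventually (hφ.usc (L z) hz y hy)
  submean a b h := by
    have := hφ.submean (L a) (L b) fun ζ hζ => by simpa using h ζ hζ
    simpa using this

theorem exists_tube_subset {H : Type*} [NormedAddCommGroup H] {G : ℂ → H} {R : ℝ} {V : Set H}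
    (hG : ContinuousOn G (Metric.closedBall 0 R)) (hV : IsOpen V)
    (h : ∀ ζ, ‖ζ‖ ≤ R → G ζ ∈ V) : ∃ δ > 0, ∀ ζ w, ‖ζ‖ ≤ R → ‖w - G ζ‖ < δ → w ∈ V := by
  obtain ⟨δ, hδ, hsub⟩ := ((isCompact_closedBall (0 : ℂ) R).image_of_continuousOn
    hG).exists_thickening_subset_open hV (image_subset_iff.2 fun ζ hζ => h ζ (by simpa using hζ))
  refine ⟨δ, hδ, fun ζ w hζ hw => hsub ?_⟩
  refine Metric.mem_thickening_iff.2 ⟨G ζ, mem_image_of_mem _ (by simpa using hζ), ?_⟩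
  rwa [dist_eq_norm]

set_option maxHeartbeats 1000000 in
/-- A two-constants estimate for the composition of a negative plurisubharmonic function with a
holomorphic disc in a Hilbert space. -/
theorem IsPlurisubharmonicOn.two_constants_hilbert {H : Type*} [NormedAddCommGroup H]
    [InnerProductSpace ℂ H] [CompleteSpace H] {φ : H → EReal} {Ω : Set H} (hΩ : IsOpen Ω)
    (hφ : IsPlurisubharmonicOn φ Ω) (hneg : ∀ z ∈ Ω, φ z < 0) {G : ℂ → H} {s R₁ R₂ ρ c : ℝ}
    (hρ : 0 < ρ) (hc : c < 0) (hR : R₁ < R₂) (hs : R₂ < s)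
    (hG : DifferentiableOn ℂ G (Metric.ball 0 s)) (hGΩ : ∀ ζ, ‖ζ‖ ≤ R₂ → G ζ ∈ Ω)
    (hGc : ∀ ζ, ‖ζ‖ ≤ ρ → φ (G ζ) < c) (hρR : ρ ≤ R₂) {ζ₁ : ℂ} (hζ₁ : ρ / 2 ≤ ‖ζ₁‖)
    (hζ₁R : ‖ζ₁‖ < R₁) :
    φ (G ζ₁) ≤ ((-(-c * ρ ^ 2 / 4 * (‖ζ₁⁻¹‖ ^ 2 - (R₁ ^ 2)⁻¹)) : ℝ) : EReal) := by
  set A : ℝ := -c * ρ ^ 2 / 4 with hA_def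
  have hA : 0 < A := by have := neg_pos.2 hc; positivity
  have hR₁ : 0 < R₁ := (norm_nonneg _).trans_lt hζ₁R
  have hR₂ : 0 < R₂ := hR₁.trans hR
  -- A strictly superharmonic barrier vanishing on `‖ζ‖ = R₁`; strictness supplies the gain of order
  -- `ε ^ 2`.
  set ψ : ℂ → ℝ := fun ζ => -(A * (‖ζ⁻¹‖ ^ 2 - (R₁ ^ 2)⁻¹)) with hψ_def
  by_contra! hcon
  have hGcont : ContinuousOn G (Metric.closedBall 0 R₂) :=
    hG.continuousOn.mono (Metric.closedBall_subset_ball hs)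
  obtain ⟨δ₁, hδ₁, htube₁⟩ := exists_tube_subset hGcont hΩ hGΩ
  obtain ⟨δ₂, hδ₂, htube₂⟩ := exists_tube_subset
    (hGcont.mono (Metric.closedBall_subset_closedBall hρR)) (hφ.isOpen_lt hΩ (c : EReal))
    (fun ζ hζ => ⟨hGΩ ζ (hζ.trans hρR), hGc ζ hζ⟩)
  set δ := min δ₁ δ₂ with hδ_def
  have hδ : 0 < δ := lt_min hδ₁ hδ₂
  -- `M * (δ / 2) ^ 2 = -c`: the penalty confines near-maximal points to the inner half of the tube.
  set M : ℝ := 4 * -c / δ ^ 2 with hM_def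
  have hM : 0 < M := by have := neg_pos.2 hc; positivity
  have hψc : ∀ ζ : ℂ, ρ / 2 ≤ ‖ζ‖ → c ≤ ψ ζ := fun ζ hζ => by
    have h1 : ‖ζ⁻¹‖ ^ 2 ≤ ((ρ / 2)⁻¹) ^ 2 := by
      rw [norm_inv]; gcongr
    have h2 : A * ((ρ / 2)⁻¹) ^ 2 = -c := by rw [hA_def]; field_simp; norm_num
    have h3 : 0 ≤ (R₁ ^ 2)⁻¹ := by positivity
    simp only [hψ_def]
    nlinarith
  have hψ0 : ∀ ζ : ℂ, R₁ ≤ ‖ζ‖ → 0 ≤ ψ ζ := fun ζ hζ => by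
    have h1 : ‖ζ⁻¹‖ ^ 2 ≤ (R₁ ^ 2)⁻¹ := by
      rw [norm_inv, ← inv_pow]; gcongr
    simp only [hψ_def]
    nlinarith
  -- Its supremum is that of `φ w - ψ ζ - M * ‖w - G ζ‖ ^ 2` over the tube, written through real
  -- minorants because `φ` may be `-∞`.
  set T : Set ℝ := {t | ∃ ζ w, ρ / 2 ≤ ‖ζ‖ ∧ ‖ζ‖ ≤ R₂ ∧ ‖w - G ζ‖ < δ ∧
    ((t + ψ ζ + M * ‖w - G ζ‖ ^ 2 : ℝ) : EReal) ≤ φ w} with hT_def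
  have hT : ∀ t ∈ T, t ≤ -c := by
    rintro t ⟨ζ, w, hζ, hζR, hw, ht⟩
    have h1 := ht.trans_lt (hneg w (htube₁ ζ w hζR (hw.trans_le (min_le_left _ _))))
    rw [← EReal.coe_zero, EReal.coe_lt_coe_iff] at h1
    have := hψc ζ hζ
    nlinarith [sq_nonneg ‖w - G ζ‖]
  have hTbdd : BddAbove T := ⟨-c, hT⟩
  obtain ⟨t₀, ht₀pos, ht₀⟩ : ∃ t₀ > 0, t₀ ∈ T := by
    obtain ⟨x, hx1, hx2⟩ := EReal.lt_iff_exists_real_btwn.1 hcon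
    rw [EReal.coe_lt_coe_iff] at hx1
    refine ⟨x - ψ ζ₁, by simp only [hψ_def]; linarith, ζ₁, G ζ₁, hζ₁, (hζ₁R.trans hR).le,
      by simpa using hδ, ?_⟩
    simpa using hx2.le
  set S := sSup T with hS_def
  have hS : 0 < S := ht₀pos.trans_le (le_csSup hTbdd ht₀)
  have hbound : ∀ ζ w, ρ / 2 ≤ ‖ζ‖ → ‖ζ‖ ≤ R₂ → ‖w - G ζ‖ < δ →
      φ w ≤ ((S + ψ ζ + M * ‖w - G ζ‖ ^ 2 : ℝ) : EReal) := fun ζ w hζ hζR hw => by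
    by_contra! hlt
    obtain ⟨x, hx1, hx2⟩ := EReal.lt_iff_exists_real_btwn.1 hlt
    rw [EReal.coe_lt_coe_iff] at hx1
    have : x - ψ ζ - M * ‖w - G ζ‖ ^ 2 ∈ T := ⟨ζ, w, hζ, hζR, hw, by
      convert hx2.le using 2; ring⟩
    have := le_csSup hTbdd this
    linarith
  set κ := A / (R₂ ^ 2) ^ 2 with hκ_def
  have hκ : 0 < κ := by positivity
  -- Makes the penalty's loss `M * (η * ε) ^ 2` half of the barrier's gain `κ * ε ^ 2`.
  set η := √(κ / (2 * M)) with hη_def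
  have hη : 0 < η := Real.sqrt_pos.2 (by positivity)
  have hη2 : M * η ^ 2 = κ / 2 := by
    rw [hη_def, Real.sq_sqrt (by positivity)]; field_simp
  obtain ⟨ε₀, hε₀, hunif⟩ := exists_uniform_differentiable_of_isCompact hs hG hη
  -- The bounds ensure, in order: the tangent approximation, `ρ / 2 ≤ ‖ζ + ε * z‖`, `‖ζ + ε * z‖ ≤
  -- R₂`, and staying in the tube.
  obtain ⟨ε, hε, hεlt⟩ : ∃ ε > 0, ε < min ε₀ (min (ρ / 4) (min (R₂ - R₁) (δ / (2 * η)))) :=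
    exists_between (by
      have := sub_pos.2 hR
      positivity)
  simp only [lt_min_iff] at hεlt
  obtain ⟨hε1, hε2, hε3, hε4⟩ := hεlt
  rw [lt_div_iff₀ (by positivity)] at hε4
  -- The supremum need not be attained in infinite dimension; a defect below the net gain `κ * ε ^ 2
  -- / 2` suffices.
  obtain ⟨t, htT, htS⟩ := exists_lt_of_lt_csSup ⟨t₀, ht₀⟩
    (show S - min S (κ * ε ^ 2 / 4) < S by
      have : 0 < min S (κ * ε ^ 2 / 4) := by positivity
      linarith)
  have ht0 : 0 < t := by linarith [min_le_left S (κ * ε ^ 2 / 4)]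
  obtain ⟨ζ, w, hζ, hζR, hw, ht⟩ := htT
  have hφw := hneg w (htube₁ ζ w hζR (hw.trans_le (min_le_left _ _)))
  have hζρ : ρ < ‖ζ‖ := by
    by_contra! hle
    have h1 := ht.trans_lt (htube₂ ζ w hle (hw.trans_le (min_le_right _ _))).2
    rw [EReal.coe_lt_coe_iff] at h1
    nlinarith [hψc ζ hζ, sq_nonneg ‖w - G ζ‖]
  have h1 := ht.trans_lt hφw
  rw [← EReal.coe_zero, EReal.coe_lt_coe_iff] at h1
  have hζR₁ : ‖ζ‖ < R₁ := by
    by_contra! hle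
    nlinarith [hψ0 ζ hle, sq_nonneg ‖w - G ζ‖]
  have hw2 : ‖w - G ζ‖ < δ / 2 := by
    have h2 : M * ‖w - G ζ‖ ^ 2 < -c := by nlinarith [hψc ζ hζ]
    have h3 : M * (δ / 2) ^ 2 = -c := by rw [hM_def]; field_simp; ring
    rw [← h3] at h2
    exact lt_of_pow_lt_pow_left₀ 2 (by positivity) (lt_of_mul_lt_mul_left h2 hM.le)
  have hnorm : ∀ z : ℂ, ‖z‖ ≤ 1 → ‖(ε : ℂ) * z‖ ≤ ε := fun z hz => by
    rw [norm_mul, Complex.norm_real, Real.norm_of_nonneg hε.le]; nlinarith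
  have hzR : ∀ z : ℂ, ‖z‖ ≤ 1 → ‖ζ + ε * z‖ ≤ R₂ := fun z hz => by
    linarith [norm_add_le ζ (ε * z), hnorm z hz]
  have he : ∀ z : ℂ, ‖z‖ ≤ 1 → ‖G (ζ + ε * z) - G ζ - (ε * z) • deriv G ζ‖ ≤ η * ε :=
    fun z hz => (hunif ζ (ε * z) hζR (hzR z hz) ((hnorm z hz).trans_lt hε1)).trans (by
      have := hnorm z hz
      gcongr)
  have hstep : ∀ z : ℂ, ‖z‖ ≤ 1 → ‖w + z • ((ε : ℂ) • deriv G ζ) - G (ζ + ε * z)‖ < δ :=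
    fun z hz => by
      have : w + z • ((ε : ℂ) • deriv G ζ) - G (ζ + ε * z) =
          (w - G ζ) - (G (ζ + ε * z) - G ζ - (ε * z) • deriv G ζ) := by
        simp only [smul_smul, mul_comm z]
        abel
      rw [this]
      refine (norm_sub_le _ _).trans_lt ?_
      nlinarith [he z hz]
  have key := hφ.penalized_le (G := G) (ζ := ζ) (w := w) (ε := ε) (η := η) (A := A)
    (B := (R₁ ^ 2)⁻¹) (M := M) (R := R₂) (S := S) hA.le hM.le hε (by linarith) hζR
    (hG.mono fun z hz => by
      rw [mem_ball_zero_iff]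
      have : ‖z - ζ‖ ≤ ε := by simpa [dist_eq_norm] using hz
      linarith [norm_le_norm_add_norm_sub' z ζ])
    (fun z hz => htube₁ _ _ (hzR z hz) ((hstep z hz).trans_le (min_le_left _ _)))
    (fun z hz => hzR z hz.le) (fun z hz => he z hz.le) fun z hz => ?_
  · have h2 := ht.trans key
    rw [EReal.coe_le_coe_iff] at h2
    have h3 : A * (ε / R₂ ^ 2) ^ 2 = κ * ε ^ 2 := by rw [hκ_def]; ring
    have h4 : M * (η * ε) ^ 2 = κ / 2 * ε ^ 2 := by rw [← hη2]; ring
    have h5 := min_le_right S (κ * ε ^ 2 / 4)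
    have h6 : 0 < κ * ε ^ 2 := by positivity
    simp only [hψ_def] at h2
    linarith
  · have h2 : ρ / 2 ≤ ‖ζ + ε * z‖ := by
      have := norm_sub_le (ζ + ε * z) (ε * z)
      rw [add_sub_cancel_right] at this
      linarith [hnorm z hz.le]
    refine (hbound _ _ h2 (hzR z hz.le) (hstep z hz.le)).trans_eq ?_
    simp only [hψ_def]
    congr 2

/-- A holomorphic disc in a Banach space factors, on a smaller disc, through a holomorphic disc in
a Hilbert space and a continuous linear map. -/
theorem exists_factor_hilbert {X : Type*} [NormedAddCommGroup X] [NormedSpace ℂ X]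
    [CompleteSpace X] {F : ℂ → X} {s r : ℝ} (hs : 0 < s) (hsr : s < r)
    (hF : DifferentiableOn ℂ F (Metric.ball 0 r)) :
    ∃ (G : ℂ → lp (fun _ : ℕ => ℂ) 2) (L : lp (fun _ : ℕ => ℂ) 2 →L[ℂ] X),
      DifferentiableOn ℂ G (Metric.ball 0 s) ∧ ∀ ζ ∈ Metric.ball (0 : ℂ) s, L (G ζ) = F ζ := by
  obtain ⟨s', hss', hs'r⟩ := exists_between hsr
  obtain ⟨t, hst, htr'⟩ := exists_between hs'r
  obtain ⟨t', htt', htr⟩ := exists_between htr'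
  have hs' : 0 < s' := hs.trans hss'
  have ht : 0 < t := hs'.trans hst
  have ht' : 0 < t' := ht.trans htt'
  lift t to NNReal using ht.le
  lift t' to NNReal using ht'.le
  obtain ⟨p, hps⟩ : ∃ p, HasFPowerSeriesOnBall F p 0 t' :=
    ⟨_, (hF.mono (Metric.closedBall_subset_ball htr)).hasFPowerSeriesOnBall ht'⟩
  obtain ⟨C, hC0, hC⟩ := p.norm_mul_pow_le_of_lt_radius
    ((ENNReal.coe_lt_coe.2 htt').trans_le hps.r_le)
  have hcoeff : ∀ j, ‖s' ^ j • p.coeff j‖ ≤ C * (s' / t) ^ j := fun j => by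
    have h1 : ‖p.coeff j‖ ≤ ‖p j‖ := by
      simp
    rw [norm_smul, norm_pow, Real.norm_of_nonneg hs'.le, div_pow, mul_div_assoc', le_div_iff₀
      (by positivity)]
    have := (mul_le_mul_of_nonneg_right h1 (pow_nonneg ht.le j)).trans (hC j)
    calc s' ^ j * ‖p.coeff j‖ * t ^ j = s' ^ j * (‖p.coeff j‖ * t ^ j) := by ring
      _ ≤ s' ^ j * C := by gcongr
      _ = C * s' ^ j := mul_comm _ _
  have hproj : ∀ j : ℕ, ∃ P : lp (fun _ : ℕ => ℂ) 2 →L[ℂ] ℂ, ‖P‖ ≤ 1 ∧ ∀ w, P w = w j := fun j =>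
    ⟨LinearMap.mkContinuous ⟨⟨fun w => w j, fun _ _ => rfl⟩, fun _ _ => rfl⟩ 1 fun w => by
      rw [one_mul]; exact lp.norm_apply_le_norm two_ne_zero w j,
      LinearMap.mkContinuous_norm_le _ zero_le_one _, fun _ => rfl⟩
  choose P hP1 hP using hproj
  have hsumL : Summable fun j => (P j).smulRight (s' ^ j • p.coeff j) := by
    refine Summable.of_norm_bounded (g := fun j => C * (s' / t) ^ j) ?_ fun j => ?_
    · exact (summable_geometric_of_lt_one (by positivity) ((div_lt_one ht).2 hst)).mul_left C
    · rw [ContinuousLinearMap.norm_smulRight_apply]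
      nlinarith [hcoeff j, hP1 j, norm_nonneg (s' ^ j • p.coeff j)]
  -- The radius `s'` splits each Taylor term between `L` and `G`: `s' < t` makes `L` converge in
  -- norm, `s < s'` makes `G` converge.
  set L : lp (fun _ : ℕ => ℂ) 2 →L[ℂ] X := ∑' j, (P j).smulRight (s' ^ j • p.coeff j) with hL
  have hLsingle : ∀ j, L (lp.single 2 j 1) = s' ^ j • p.coeff j := fun j => by
    have h1 := hsumL.hasSum.mapL (ContinuousLinearMap.apply ℂ X (lp.single 2 j (1 : ℂ)))
    refine h1.unique (hasSum_single j fun i hi => ?_) |>.trans ?_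
    · simp [hP, Pi.single_eq_of_ne hi]
    · simp [hP]
  set g : ℕ → ℂ → lp (fun _ : ℕ => ℂ) 2 := fun j ζ => (ζ / s') ^ j • lp.single 2 j (1 : ℂ) with hg
  have hgeom : Summable fun j : ℕ => (s / s') ^ j :=
    summable_geometric_of_lt_one (by positivity) ((div_lt_one hs').2 hss')
  have hgle : ∀ j, ∀ ζ ∈ Metric.ball (0 : ℂ) s, ‖g j ζ‖ ≤ (s / s') ^ j := fun j ζ hζ => by
    have h1 : ‖ζ‖ ≤ s := (mem_ball_zero_iff.1 hζ).le
    rw [hg, norm_smul, lp.norm_single two_pos, norm_one, mul_one, norm_pow, norm_div,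
      Complex.norm_real, Real.norm_of_nonneg hs'.le]
    gcongr
  refine ⟨fun ζ => ∑' j, g j ζ, L, Complex.differentiableOn_tsum_of_summable_norm hgeom
    (fun j => by fun_prop) Metric.isOpen_ball hgle, fun ζ hζ => ?_⟩
  have h1 : HasSum (fun j => L (g j ζ)) (L (∑' j, g j ζ)) :=
    (Summable.of_norm_bounded hgeom fun j => hgle j ζ hζ).hasSum.mapL L
  have h2 : HasSum (fun j => L (g j ζ)) (F ζ) := by
    have h3 := hps.hasSum (y := ζ) (by
      rw [Metric.mem_eball, edist_zero_right, ← ofReal_norm,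
        ← ENNReal.ofReal_coe_nnreal, ENNReal.ofReal_lt_ofReal_iff ht']
      linarith [mem_ball_zero_iff.1 hζ])
    rw [zero_add] at h3
    refine h3.congr_fun fun j => ?_
    have hs0 : (s' : ℂ) ≠ 0 := by exact_mod_cast hs'.ne'
    rw [p.apply_eq_pow_smul_coeff, hg, map_smul, hLsingle, ← Complex.coe_smul, smul_smul,
      Complex.ofReal_pow, ← mul_pow, div_mul_cancel₀ _ hs0]
  exact h1.unique h2

/-- A two-constants estimate for the composition of a negative plurisubharmonic function with a
holomorphic disc in a Banach space; the constant does not depend on the disc. -/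
theorem IsPlurisubharmonicOn.exists_two_constants {X : Type*} [NormedAddCommGroup X]
    [NormedSpace ℂ X] [CompleteSpace X] {φ : X → EReal} {Ω : Set X} (hΩ : IsOpen Ω)
    (hφ : IsPlurisubharmonicOn φ Ω) (hneg : ∀ z ∈ Ω, φ z < 0) {ρ c : ℝ} (hρ : 0 < ρ) (hc : c < 0) :
    ∃ c' < 0, ∀ F : ℂ → X, DifferentiableOn ℂ F (Metric.ball 0 1) →
      (∀ ζ ∈ Metric.ball (0 : ℂ) 1, F ζ ∈ Ω) → (∀ ζ, ‖ζ‖ < ρ → φ (F ζ) < (c : EReal)) →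
      ∀ ζ, ‖ζ‖ ≤ 1 / 4 → φ (F ζ) < ((c' : ℝ) : EReal) := by
  -- Halving `ρ` turns the strict hypothesis into one on a closed disc.
  set ρ' := min (ρ / 2) (1 / 2) with hρ'_def
  have hρ' : 0 < ρ' := by positivity
  have hρ'1 : ρ' ≤ 1 / 2 := min_le_right _ _
  have hρ'2 : ρ' ≤ ρ / 2 := min_le_left _ _
  set A : ℝ := -c * ρ' ^ 2 / 4 with hA
  have hApos : 0 < A := by have := neg_pos.2 hc; positivity
  refine ⟨max c (-A), max_lt hc (by linarith), fun F hF hFΩ hFc ζ hζ => ?_⟩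
  obtain hlt | hle := lt_or_ge ‖ζ‖ (ρ' / 2)
  · exact (hFc ζ (by linarith)).trans_le (EReal.coe_le_coe_iff.2 (le_max_left _ _))
  obtain ⟨G, L, hG, hGF⟩ := exists_factor_hilbert (s := 3 / 4) (r := 1) (by norm_num)
    (by norm_num) hF
  have hGF' : ∀ ζ : ℂ, ‖ζ‖ ≤ 2 / 3 → L (G ζ) = F ζ := fun z hz =>
    hGF z (by rw [mem_ball_zero_iff]; linarith)
  have key := (hφ.comp_clm L).two_constants_hilbert (hΩ.preimage L.continuous)
    (fun z hz => hneg _ hz) (G := G) (s := 3 / 4) (R₁ := 1 / 2) (R₂ := 2 / 3) hρ' hc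
    (by norm_num) (by norm_num) hG
    (fun z hz => by
      rw [mem_preimage, hGF' z hz]
      exact hFΩ z (by rw [mem_ball_zero_iff]; linarith))
    (fun z hz => by
      rw [Function.comp_apply, hGF' z (by linarith)]
      exact hFc z (by linarith)) (by linarith) hle (by linarith)
  rw [Function.comp_apply, hGF' ζ (by linarith)] at key
  refine key.trans_lt (EReal.coe_lt_coe_iff.2 (lt_of_lt_of_le ?_ (le_max_right _ _)))
  have h4 : 16 ≤ ‖ζ⁻¹‖ ^ 2 := by
    have h5 : 0 < ‖ζ‖ := by linarith
    have : 4 ≤ ‖ζ‖⁻¹ := by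
      rw [le_inv_comm₀ (by norm_num) h5]
      linarith
    rw [norm_inv]
    nlinarith
  rw [← hA]
  nlinarith

end TwoConstants
end

noncomputable section

/-! ### The Kobayashi distance and equicontinuity -/

section Kobayashi

theorem exists_line_through {E : Type*} [NormedAddCommGroup E] [NormedSpace ℂ E] {y v : E} {R : ℝ}
    (hR : 0 < R) : ∃ (t : ℂ) (b : E), ‖t‖ = ‖v - y‖ / R ∧ ‖b‖ ≤ R ∧ y + t • b = v := by
  obtain rfl | h := eq_or_ne v y
  · exact ⟨0, 0, by simp, by simpa using hR.le, by simp⟩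
  have h0 : ‖v - y‖ ≠ 0 := norm_ne_zero_iff.2 (sub_ne_zero.2 h)
  refine ⟨((‖v - y‖ / R : ℝ) : ℂ), ((R / ‖v - y‖ : ℝ) : ℂ) • (v - y), ?_, ?_, ?_⟩
  · rw [Complex.norm_real, Real.norm_of_nonneg (by positivity)]
  · rw [norm_smul, Complex.norm_real, Real.norm_of_nonneg (by positivity), div_mul_cancel₀ _ h0]
  · rw [smul_smul, ← Complex.ofReal_mul, div_mul_div_cancel₀ hR.ne', div_self h0]
    simp

theorem mem_ball_of_norm_lt_one {E : Type*} [NormedAddCommGroup E] [NormedSpace ℂ E] {y b : E}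
    {R : ℝ} (hR : 0 < R) (hb : ‖b‖ ≤ R) {ζ : ℂ} (hζ : ζ ∈ Metric.ball (0 : ℂ) 1) :
    y + ζ • b ∈ Metric.ball y R := by
  rw [mem_ball_zero_iff] at hζ
  rw [mem_ball_iff_norm, add_sub_cancel_left, norm_smul]
  nlinarith [norm_nonneg b, norm_nonneg ζ]

theorem Real.artanh_lt_of_lt_tanh {x ε : ℝ} (hx : 0 ≤ x) (h : x < Real.tanh ε) :
    Real.artanh x < ε := by
  rw [← Real.artanh_tanh ε]
  exact Real.artanh_lt_artanh (by linarith) (Real.tanh_lt_one ε) h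

theorem Real.le_two_mul_artanh {x : ℝ} (hx : 0 ≤ x) (hx1 : x < 1) : x ≤ 2 * Real.artanh x := by
  rw [Real.artanh_eq_half_log ⟨by linarith, hx1.le⟩]
  have h1 : 0 < 1 - x := by linarith
  have h2 : 0 < 1 + x := by linarith
  have := Real.one_sub_inv_le_log_of_pos (div_pos h2 h1)
  have h3 : x ≤ 1 - ((1 + x) / (1 - x))⁻¹ := by
    rw [inv_div, le_sub_iff_add_le, ← le_sub_iff_add_le', div_le_iff₀ h2]
    nlinarith
  linarith

/-- The origin of the unit disc. -/
def unitDisc.origin : unitDisc := ⟨0, Metric.mem_ball_self one_pos⟩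

theorem poincareDist_origin (b : unitDisc) :
    poincareDist unitDisc.origin b = Real.artanh ‖(b : ℂ)‖ := by
  simp [poincareDist, unitDisc.origin]

theorem poincareDist_nonneg (a b : unitDisc) : 0 ≤ poincareDist a b :=
  Real.artanh_nonneg (by positivity)

variable {F : Type*} [NormedAddCommGroup F] [NormedSpace ℂ F]
  {X : Type*} [TopologicalSpace X] [ChartedSpace F X]

theorem kobayashi_le_of_two_discs (f g : Hol ℂ unitDisc F X) {a b a' b' : unitDisc}
    (h : f.1 b = g.1 a') :
    kobayashi F (f.1 a) (g.1 b') ≤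
      ENNReal.ofReal (poincareDist a b + poincareDist a' b') := by
  refine (iInf_le _ { n := 2, pt := ![f.1 a, f.1 b, g.1 b'], a := ![a, a'], b := ![b, b'],
                      f := ![f, g],
                      map_a := by simp [Fin.forall_fin_two, h],
                      map_b := by simp [Fin.forall_fin_two],
                      pt_zero := rfl, pt_last := rfl }).trans_eq ?_
  simp [HolChain.length]

variable {X : Type u} [NormedAddCommGroup X] [NormedSpace ℂ X] {Ω : Opens X}
  {E : Type*} [NormedAddCommGroup E] [NormedSpace ℂ E]

theorem exists_disc_of_differentiableOn {f : E → X} {y v : E} {R : ℝ} (hR : 0 < R)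
    (hf : DifferentiableOn ℂ f (Metric.ball y R)) (hΩ : MapsTo f (Metric.ball y R) Ω)
    (hv : v ∈ Metric.ball y R) :
    ∃ (g : Hol ℂ unitDisc X Ω) (b : unitDisc), (g.1 unitDisc.origin : X) = f y ∧
      (g.1 b : X) = f v ∧ ‖(b : ℂ)‖ = ‖v - y‖ / R := by
  obtain ⟨t, b, ht, hb, htb⟩ := exists_line_through (y := y) (v := v) hR
  have hm : MapsTo (fun ζ : ℂ => y + ζ • b) (Metric.ball 0 1) (Metric.ball y R) :=
    fun ζ hζ => mem_ball_of_norm_lt_one hR hb hζ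
  refine ⟨holOfDifferentiableOn (fun ζ : ℂ => f (y + ζ • b)) (hf.comp (by fun_prop) hm)
    (hΩ.comp hm), ⟨t, ?_⟩, ?_, ?_, ht⟩
  · change t ∈ Metric.ball (0 : ℂ) 1
    rw [mem_ball_zero_iff, ht, div_lt_one hR]
    exact mem_ball_iff_norm.1 hv
  · change f (y + (0 : ℂ) • b) = f y
    rw [zero_smul, add_zero]
  · exact congrArg f htb

/-- A chain of two links: an affine disc in the ball about `q` reaches `f y`, then `f` of an affine
disc through `y` and `v` reaches `f v`. -/
theorem kobayashi_le_artanh_add_artanh {f : E → X} {y v : E} {R r : ℝ} {q : Ω} (hR : 0 < R)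
    (hr : 0 < r) (hball : Metric.ball (q : X) r ⊆ Ω)
    (hf : DifferentiableOn ℂ f (Metric.ball y R)) (hΩ : MapsTo f (Metric.ball y R) Ω)
    (hv : v ∈ Metric.ball y R) (hy : f y ∈ Metric.ball (q : X) r) :
    kobayashi X q ⟨f v, hΩ hv⟩ ≤
      ENNReal.ofReal (Real.artanh (‖f y - q‖ / r) + Real.artanh (‖v - y‖ / R)) := by
  obtain ⟨g₁, b₁, h₁, h₁', hb₁⟩ := exists_disc_of_differentiableOn (f := (id : X → X)) hr
    differentiableOn_id hball hy
  obtain ⟨g₂, b₂, h₂, h₂', hb₂⟩ := exists_disc_of_differentiableOn hR hf hΩ hv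
  have := kobayashi_le_of_two_discs g₁ g₂ (a := unitDisc.origin) (b := b₁) (a' := unitDisc.origin)
    (b' := b₂) (Subtype.ext (by rw [h₁', h₂]; rfl))
  rw [poincareDist_origin, poincareDist_origin, hb₁, hb₂] at this
  have e₁ : g₁.1 unitDisc.origin = q := Subtype.ext h₁
  have e₂ : g₂.1 b₂ = ⟨f v, hΩ hv⟩ := Subtype.ext h₂'
  rwa [e₁, e₂] at this

/-- Near every point the Kobayashi pseudo-distance is dominated by the norm. -/
theorem exists_kobayashi_lt (q : Ω) {ε : ℝ≥0∞} (hε : 0 < ε) :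
    ∃ δ > 0, ∀ {E : Type w} [NormedAddCommGroup E] [NormedSpace ℂ E] {f : E → X} {y v : E} {R : ℝ}
      (_ : DifferentiableOn ℂ f (Metric.ball y R)) (hΩ : MapsTo f (Metric.ball y R) Ω)
      (hv : v ∈ Metric.ball y R), ‖f y - q‖ < δ → ‖v - y‖ < δ * R →
      kobayashi X q ⟨f v, hΩ hv⟩ < ε := by
  obtain ⟨r, hr, hball⟩ := Metric.isOpen_iff.1 Ω.2 q q.2
  obtain ⟨ε', -, hε', hε'ε⟩ := ENNReal.lt_iff_exists_real_btwn.1 hε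
  rw [ENNReal.ofReal_pos] at hε'
  have htanh : 0 < Real.tanh (ε' / 2) := by
    rw [Real.tanh_eq_sinh_div_cosh]
    exact div_pos (Real.sinh_pos_iff.2 (by linarith)) (Real.cosh_pos _)
  refine ⟨min (Real.tanh (ε' / 2)) (min (Real.tanh (ε' / 2) * r) r), by positivity, ?_⟩
  intro E _ _ f y v R hf hΩ hv hy hvy
  have hR : 0 < R := Metric.pos_of_mem_ball hv
  simp only [lt_min_iff] at hy
  have hvy' : ‖v - y‖ / R < Real.tanh (ε' / 2) := by
    rw [div_lt_iff₀ hR]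
    exact hvy.trans_le (mul_le_mul_of_nonneg_right (min_le_left _ _) hR.le)
  have hy' : ‖f y - q‖ / r < Real.tanh (ε' / 2) := (div_lt_iff₀ hr).2 hy.2.1
  refine (kobayashi_le_artanh_add_artanh hR hr hball hf hΩ hv
    (mem_ball_iff_norm.2 hy.2.2)).trans_lt (lt_trans ?_ hε'ε)
  rw [ENNReal.ofReal_lt_ofReal_iff hε']
  linarith [Real.artanh_lt_of_lt_tanh (by positivity) hvy',
    Real.artanh_lt_of_lt_tanh (by positivity) hy']

/-- Holomorphic maps into a hyperbolic open set are equicontinuous. -/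
theorem IsHyperbolic.exists_mapsTo (h : IsHyperbolic X Ω) {q : Ω} {S : Set X} (hS : IsOpen S)
    (hq : (q : X) ∈ S) :
    ∃ δ > 0, ∀ {E : Type w} [NormedAddCommGroup E] [NormedSpace ℂ E] {f : E → X} {y v : E} {R : ℝ}
      (_ : DifferentiableOn ℂ f (Metric.ball y R)) (_ : MapsTo f (Metric.ball y R) Ω)
      (_ : v ∈ Metric.ball y R), ‖f y - q‖ < δ → ‖v - y‖ < δ * R → f v ∈ S := by
  obtain ⟨ε, hε, H⟩ := (h.2 (Subtype.val ⁻¹' S)).1 (hS.preimage continuous_subtype_val) q hq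
  obtain ⟨δ, hδ, K⟩ := exists_kobayashi_lt.{u, w} q hε
  exact ⟨δ, hδ, fun hf hΩ hv hy hvy => H _ (K hf hΩ hv hy hvy)⟩

/-- The other comparison of topologies always holds, by `exists_kobayashi_lt`. -/
theorem isHyperbolic_of_exists (h : ∀ p : Ω, ∀ r > 0, ∃ ε : ℝ≥0∞, 0 < ε ∧
    ∀ q : Ω, kobayashi X p q < ε → ‖(q : X) - p‖ < r) : IsHyperbolic X Ω := by
  refine ⟨fun p q hpq => ?_, fun S => ⟨fun hS p hp => ?_, fun hS => ?_⟩⟩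
  · by_contra hne
    have : 0 < ‖(q : X) - p‖ := norm_pos_iff.2 (sub_ne_zero.2 fun h => hne (Subtype.ext h.symm))
    obtain ⟨ε, hε, H⟩ := h p _ this
    exact (H q (hpq ▸ hε)).false
  · obtain ⟨r, hr, hball⟩ := Metric.isOpen_iff.1 hS p hp
    obtain ⟨ε, hε, H⟩ := h p r hr
    exact ⟨ε, hε, fun q hq => hball (by
      rw [Metric.mem_ball, Subtype.dist_eq, dist_eq_norm]; exact H q hq)⟩
  · refine Metric.isOpen_iff.2 fun p hp => ?_
    obtain ⟨ε, hε, H⟩ := hS p hp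
    obtain ⟨r, hr, hball⟩ := Metric.isOpen_iff.1 Ω.2 p p.2
    obtain ⟨δ, hδ, K⟩ := exists_kobayashi_lt.{u, u} p hε
    refine ⟨min r (δ * r), by positivity, fun q hq => H q ?_⟩
    rw [Metric.mem_ball, Subtype.dist_eq, dist_eq_norm, lt_min_iff] at hq
    exact K (f := id) differentiableOn_id hball (mem_ball_iff_norm.2 hq.1) (by simpa using hδ) hq.2

end Kobayashi

/-! ### Automorphisms of the disc -/

section Moebius

theorem norm_moebius_lt_one {a z : ℂ} (ha : ‖a‖ < 1) (hz : ‖z‖ < 1) :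
    ‖(z + a) / (1 + (starRingEnd ℂ) a * z)‖ < 1 := by
  have key : ‖1 + (starRingEnd ℂ) a * z‖ ^ 2 - ‖z + a‖ ^ 2 = (1 - ‖a‖ ^ 2) * (1 - ‖z‖ ^ 2) := by
    simp only [← Complex.normSq_eq_norm_sq, Complex.normSq_apply, Complex.add_re, Complex.add_im,
      Complex.mul_re, Complex.mul_im, Complex.conj_re, Complex.conj_im, Complex.one_re,
      Complex.one_im]
    ring
  have hpos : 0 < (1 - ‖a‖ ^ 2) * (1 - ‖z‖ ^ 2) := by
    have := norm_nonneg a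
    have := norm_nonneg z
    exact mul_pos (by nlinarith) (by nlinarith)
  have hlt : ‖z + a‖ < ‖1 + (starRingEnd ℂ) a * z‖ :=
    lt_of_pow_lt_pow_left₀ 2 (norm_nonneg _) (by linarith)
  rw [norm_div, div_lt_one ((norm_nonneg _).trans_lt hlt)]
  exact hlt

theorem one_add_conj_mul_ne_zero {a z : ℂ} (ha : ‖a‖ < 1) (hz : ‖z‖ < 1) :
    1 + (starRingEnd ℂ) a * z ≠ 0 := fun h => by
  have h1 : (starRingEnd ℂ) a * z = -1 := by linear_combination h
  have h2 := congrArg norm h1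
  rw [norm_mul, RCLike.norm_conj, norm_neg, norm_one] at h2
  nlinarith [norm_nonneg a, norm_nonneg z]

end Moebius
end

noncomputable section

/-! ### From SVP to hyperbolicity and QSVP -/

section StrongVitali

variable {X : Type u} [NormedAddCommGroup X] [NormedSpace ℂ X] {Ω : Opens X}

theorem eventually_ulift_notMem (s : Finset (ULift.{v} ℕ)) :
    ∀ᶠ k : ℕ in atTop, (⟨k⟩ : ULift.{v} ℕ) ∉ s := by
  rw [← Nat.cofinite_eq_atTop]
  rw [eventually_cofinite]
  exact (s.finite_toSet.preimage ULift.up_injective.injOn).subset fun k hk => not_not.1 hk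

theorem dense_eventually_zero (U : Opens (lp (fun _ : ULift.{v} ℕ => ℂ) 2)) :
    Dense {w : U | ∀ᶠ k : ℕ in atTop, w.1 ⟨k⟩ = 0} := by
  intro w
  rw [mem_closure_iff_nhds]
  intro V hV
  rw [mem_nhds_subtype_iff_nhdsWithin, U.isOpen.nhdsWithin_eq w.2] at hV
  have h := (lp.hasSum_single (p := 2) (by simp) w.1).eventually
    (Filter.Eventually.and (show ∀ᶠ y in 𝓝 w.1, y ∈ Subtype.val '' V from hV) (U.2.mem_nhds w.2))
  obtain ⟨s, ⟨hs, hsU⟩⟩ := h.exists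
  obtain ⟨y, hyV, hy⟩ := hs
  refine ⟨y, hyV, ?_⟩
  filter_upwards [eventually_ulift_notMem s] with k hk
  rw [hy, lp.coeFn_sum, Finset.sum_apply]
  refine Finset.sum_eq_zero fun i hi => ?_
  rw [lp.single_apply]
  exact Pi.single_eq_of_ne (ne_of_mem_of_not_mem hi hk).symm _

theorem mem_uniquenessSet_of_dense {E : Type*} [NormedAddCommGroup E] [NormedSpace ℂ E]
    {A : Type*} [TopologicalSpace A] [ChartedSpace E A] {S : Set A} (hS : Dense S) (z : A) :
    z ∈ uniquenessSet E S := by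
  refine ⟨hS z, fun U hU _ _ g hg h a ha => ?_⟩
  have hcont : ContinuousOn g U := hg.continuousOn
  have hcl : a ∈ closure (U ∩ S) := hS.open_subset_closure_inter hU ha
  have h2 := (hcont a ha).mono_left (nhdsWithin_mono a (inter_subset_left (t := S)))
  have h3 : (𝓝[U ∩ S] a).NeBot := mem_closure_iff_nhdsWithin_neBot.1 hcl
  exact tendsto_nhds_unique (h2.congr' (eventually_nhdsWithin_of_forall h))
    tendsto_const_nhds

/-- In an open set with the strong Vitali property, discs centred near a point stay near that point
on a disc of a fixed size. -/
theorem HasSVP.exists_disc_bound (h : HasSVP.{v} X Ω) (p : Ω) {r : ℝ} (hr : 0 < r) :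
    ∃ δ > 0, ∀ F : ℂ → X, DifferentiableOn ℂ F (Metric.ball 0 1) →
      MapsTo F (Metric.ball 0 1) Ω → ‖F 0 - p‖ < δ → ∀ z ∈ Metric.ball (0 : ℂ) 1, ‖z‖ < δ →
      ‖F z - p‖ < r := by
  by_contra! hcon
  choose! F hF hFΩ hF0 z hz1 hz hFz using fun k : ℕ =>
    hcon (1 / ((k : ℝ) + 1)) Nat.one_div_pos_of_nat
  -- An infinite-dimensional source gives each disc its own coordinate; `ULift` puts it in the
  -- universe over which SVP quantifies.
  let B : Opens (lp (fun _ : ULift.{v} ℕ => ℂ) 2) := ⟨Metric.ball 0 1, Metric.isOpen_ball⟩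
  have : ConnectedSpace B := isConnected_iff_connectedSpace.1
    ((convex_ball _ _).isConnected ⟨0, Metric.mem_ball_self one_pos⟩)
  let π : ℕ → lp (fun _ : ULift.{v} ℕ => ℂ) 2 →L[ℂ] ℂ := fun k =>
    lp.evalCLM ℂ (fun _ : ULift.{v} ℕ => ℂ) 2 ⟨k⟩
  have hπ : ∀ k, MapsTo (π k) B (Metric.ball 0 1) := fun k w hw => by
    rw [mem_ball_zero_iff]
    exact (lp.norm_apply_le_norm two_ne_zero w _).trans_lt (mem_ball_zero_iff.1 hw)
  let g : ℕ → Hol (lp (fun _ : ULift.{v} ℕ => ℂ) 2) B X Ω := fun k =>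
    holOfDifferentiableOn (F k ∘ π k) ((hF k).comp (π k).differentiable.differentiableOn (hπ k))
      ((hFΩ k).comp (hπ k))
  have hF0p : Tendsto (fun k => F k 0) atTop (𝓝 (p : X)) := by
    rw [tendsto_iff_norm_sub_tendsto_zero]
    exact squeeze_zero (fun _ => norm_nonneg _) (fun k => (hF0 k).le)
      tendsto_one_div_add_atTop_nhds_zero_nat
  have hconv : ∀ w : B, (∀ᶠ k : ℕ in atTop, w.1 ⟨k⟩ = 0) →
      Tendsto (fun k => (g k).1 w) atTop (𝓝 p) := fun w hw => by
    rw [tendsto_subtype_rng]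
    refine hF0p.congr' ?_
    filter_upwards [hw] with k hk
    change F k 0 = F k (w.1 ⟨k⟩)
    rw [hk]
  let o : B := ⟨0, Metric.mem_ball_self one_pos⟩
  have hdense : Dense (convSet g) :=
    (dense_eventually_zero B).mono fun w hw => show w ∈ convSet g from ⟨p, hconv w hw⟩
  obtain ⟨G, hG⟩ := h _ B g ⟨o, mem_uniquenessSet_of_dense hdense o⟩
  have hGp : ∀ w : B, (∀ᶠ k : ℕ in atTop, w.1 ⟨k⟩ = 0) → G.1 w = p := fun w hw =>
    tendsto_nhds_unique (tendsto_apply_of_tendsto_hol hG w) (hconv w hw)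
  let x : ℕ → B := fun k => ⟨lp.single (E := fun _ : ULift.{v} ℕ => ℂ) 2 ⟨k⟩ (z k), by
    change _ ∈ Metric.ball _ _
    rw [mem_ball_zero_iff, lp.norm_single two_pos]
    exact mem_ball_zero_iff.1 (hz1 k)⟩
  have hx : Tendsto x atTop (𝓝 o) := by
    rw [tendsto_subtype_rng]
    refine tendsto_zero_iff_norm_tendsto_zero.2 ?_
    refine squeeze_zero (fun _ => norm_nonneg _) (fun k => ?_)
      tendsto_one_div_add_atTop_nhds_zero_nat
    change ‖lp.single (E := fun _ : ULift.{v} ℕ => ℂ) 2 ⟨k⟩ (z k)‖ ≤ _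
    rw [lp.norm_single two_pos]
    exact (hz k).le
  -- Each `x k` is supported on one coordinate, so the limit equals `p` on this whole compact set.
  have hmaps : MapsTo G.1 (insert o (range x))
      (Subtype.val ⁻¹' Metric.ball (p : X) r) := by
    rintro w (rfl | ⟨k, rfl⟩)
    · rw [hGp _ (Eventually.of_forall fun k => rfl)]
      exact Metric.mem_ball_self hr
    · rw [hGp _ ?_]
      · exact Metric.mem_ball_self hr
      · filter_upwards [eventually_gt_atTop k] with j hj
        exact Pi.single_eq_of_ne (fun h => hj.ne' (ULift.up_injective h)) _
  obtain ⟨k, hk⟩ := (tendsto_hol_iff.1 hG _ hx.isCompact_insert_range _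
    (Metric.isOpen_ball.preimage continuous_subtype_val) hmaps).exists
  have h1 : F k (π k (lp.single (E := fun _ : ULift.{v} ℕ => ℂ) 2 ⟨k⟩ (z k))) ∈ Metric.ball (p : X) r :=
    hk (mem_insert_of_mem _ (mem_range_self k))
  have h2 : π k (lp.single (E := fun _ : ULift.{v} ℕ => ℂ) 2 ⟨k⟩ (z k)) = z k := lp.single_apply_self 2 _ _
  rw [h2, mem_ball_iff_norm] at h1
  exact (hFz k).not_gt h1

theorem exists_moebius_disc (f : Hol ℂ unitDisc X Ω) (a b : unitDisc) :
    ∃ (F : ℂ → X) (z : ℂ), DifferentiableOn ℂ F (Metric.ball 0 1) ∧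
      MapsTo F (Metric.ball 0 1) Ω ∧ F 0 = f.1 a ∧ z ∈ Metric.ball (0 : ℂ) 1 ∧ F z = f.1 b ∧
      ‖z‖ ≤ 2 * poincareDist a b := by
  obtain ⟨g, hg, hgf⟩ := f.exists_differentiableOn
  have ha : ‖(a : ℂ)‖ < 1 := mem_ball_zero_iff.1 a.2
  have hb : ‖(b : ℂ)‖ < 1 := mem_ball_zero_iff.1 b.2
  have hm : MapsTo (fun z : ℂ => (z + a) / (1 + (starRingEnd ℂ) (a : ℂ) * z)) (Metric.ball 0 1)
      (Metric.ball 0 1) := fun z hz =>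
    mem_ball_zero_iff.2 (norm_moebius_lt_one ha (mem_ball_zero_iff.1 hz))
  have hgΩ : MapsTo g (Metric.ball 0 1) Ω := fun z hz => by
    have := hgf ⟨z, hz⟩
    simp only at this
    rw [this]
    exact (f.1 _).2
  have hz1 : ‖((b : ℂ) - a) / (1 - (starRingEnd ℂ) (a : ℂ) * b)‖ < 1 := by
    have := norm_moebius_lt_one (a := -(a : ℂ)) (z := b) (by simpa using ha) hb
    simpa [sub_eq_add_neg] using this
  have hd : poincareDist a b =
      Real.artanh ‖((b : ℂ) - a) / (1 - (starRingEnd ℂ) (a : ℂ) * b)‖ := by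
    rw [poincareDist, norm_div, norm_sub_rev]
  have hden : 1 - (starRingEnd ℂ) (a : ℂ) * b ≠ 0 := by
    have := one_add_conj_mul_ne_zero (a := -(a : ℂ)) (z := b) (by simpa using ha) hb
    simpa [sub_eq_add_neg] using this
  refine ⟨g ∘ fun z : ℂ => (z + a) / (1 + (starRingEnd ℂ) (a : ℂ) * z),
    ((b : ℂ) - a) / (1 - (starRingEnd ℂ) (a : ℂ) * b), hg.comp (DifferentiableOn.div (by fun_prop)
      (by fun_prop) fun z hz => one_add_conj_mul_ne_zero ha (mem_ball_zero_iff.1 hz)) hm,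
    hgΩ.comp hm, by simpa using hgf a, mem_ball_zero_iff.2 hz1, ?_, ?_⟩
  · rw [← hgf b, Function.comp_apply]
    congr 1
    have hne := one_add_conj_mul_ne_zero ha hz1
    rw [div_eq_iff hne]
    linear_combination div_mul_cancel₀ ((b : ℂ) - a) hden
  · rw [hd]
    exact Real.le_two_mul_artanh (norm_nonneg _) hz1

/-- A bootstrap: the estimate so far keeps the last point within `δ` of `p`, which is what licenses
the next link. -/
theorem norm_chain_le {V : Type*} [NormedAddCommGroup V] {n : ℕ} {pt : Fin (n + 1) → V}
    {l : Fin n → ℝ} {p : V} {C δ δ' : ℝ} (hl : ∀ i, 0 ≤ l i)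
    (hC : 0 ≤ C) (hstep : ∀ i, ‖pt i.castSucc - p‖ < δ → l i < δ' →
      ‖pt i.succ - pt i.castSucc‖ ≤ C * l i)
    (h0 : pt 0 = p) (h1 : C * ∑ i, l i < δ) (h2 : ∑ i, l i < δ') :
    ‖pt (Fin.last n) - p‖ ≤ C * ∑ i, l i := by
  induction n with
  | zero => simp [← h0]
  | succ n ih =>
    rw [Fin.sum_univ_castSucc] at h1 h2 ⊢
    have hs : 0 ≤ ∑ i : Fin n, l i.castSucc := Finset.sum_nonneg fun i _ => hl _
    have hlast := hl (Fin.last n)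
    have hCl : 0 ≤ C * l (Fin.last n) := mul_nonneg hC hlast
    rw [mul_add] at h1 ⊢
    have ih' := ih (pt := fun i => pt i.castSucc) (l := fun i => l i.castSucc) (fun i => hl _)
      (fun i hi hi' => hstep i.castSucc hi hi') h0 (by linarith) (by linarith)
    have := hstep (Fin.last n) (ih'.trans_lt (by linarith)) (by linarith)
    have h3 := norm_add_le (pt (Fin.last n).succ - pt (Fin.last n).castSucc)
      (pt (Fin.last n).castSucc - p)
    rw [sub_add_sub_cancel] at h3
    rw [Fin.succ_last] at h3 this
    linarith

theorem HasSVP.isHyperbolic (h : HasSVP.{v} X Ω) : IsHyperbolic X Ω := by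
  refine isHyperbolic_of_exists fun p r hr => ?_
  obtain ⟨δ₀, hδ₀, H⟩ := h.exists_disc_bound p hr
  set δ := min (min δ₀ 1) r with hδ_def
  have hδ : 0 < δ := by positivity
  have hδδ₀ : δ ≤ δ₀ := (min_le_left _ _).trans (min_le_left _ _)
  have hδ1 : δ ≤ 1 := (min_le_left _ _).trans (min_le_right _ _)
  have hδr : δ ≤ r := min_le_right _ _
  have hlink : ∀ (f : Hol ℂ unitDisc X Ω) (a b : unitDisc), ‖(f.1 a : X) - p‖ < δ →
      poincareDist a b < δ / 2 → ‖(f.1 b : X) - f.1 a‖ ≤ 4 * r / δ * poincareDist a b := by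
    intro f a b hfa hab
    obtain ⟨F, z, hF, hFΩ, hF0, hz1, hFz, hz⟩ := exists_moebius_disc f a b
    have hFp : ∀ ζ ∈ Metric.ball (0 : ℂ) δ, ‖F ζ - p‖ < r := fun ζ hζ =>
      H F hF hFΩ (hF0 ▸ hfa.trans_le hδδ₀) ζ (Metric.ball_subset_ball hδ1 hζ)
        ((mem_ball_zero_iff.1 hζ).trans_le hδδ₀)
    have hmaps : MapsTo F (Metric.ball 0 δ) (Metric.closedBall (F 0) (2 * r)) := fun ζ hζ => by
      rw [mem_closedBall_iff_norm]
      have h1 := norm_sub_le (F ζ - p) (F 0 - p)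
      rw [sub_sub_sub_cancel_right] at h1
      linarith [hFp ζ hζ, hFp 0 (Metric.mem_ball_self hδ)]
    have hzδ : z ∈ Metric.ball (0 : ℂ) δ := mem_ball_zero_iff.2 (by linarith)
    -- Schwarz lemma on the disc of radius `δ`: displacement becomes linear in the link's length,
    -- hence summable along a chain.
    have := Complex.dist_le_div_mul_dist_of_mapsTo_ball
      (hF.mono (Metric.ball_subset_ball hδ1)) hmaps hzδ
    rw [dist_eq_norm, dist_zero_right, hF0, hFz] at this
    refine this.trans ?_
    calc 2 * r / δ * ‖z‖ ≤ 2 * r / δ * (2 * poincareDist a b) := by gcongr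
      _ = 4 * r / δ * poincareDist a b := by ring
  -- The first bound keeps the total displacement below `δ`, the second makes every link short
  -- enough for `hlink`.
  set η := min (δ / (4 * r / δ)) (δ / 2) with hη_def
  have hη : 0 < η := by positivity
  refine ⟨ENNReal.ofReal η, ENNReal.ofReal_pos.2 hη, fun q hq => ?_⟩
  obtain ⟨α, hα⟩ := iInf_lt_iff.1 hq
  rw [ENNReal.ofReal_lt_ofReal_iff hη, HolChain.length] at hα
  have h1 : 4 * r / δ * ∑ i, poincareDist (α.a i) (α.b i) < δ := by
    rw [← lt_div_iff₀' (by positivity)]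
    exact hα.trans_le (min_le_left _ _)
  have := norm_chain_le (pt := fun i => (α.pt i : X)) (p := (p : X))
    (l := fun i => poincareDist (α.a i) (α.b i)) (C := 4 * r / δ) (δ := δ) (δ' := δ / 2)
    (fun i => poincareDist_nonneg _ _) (by positivity)
    (fun i hi hi' => by
      rw [← α.map_a i] at hi
      rw [← α.map_a i, ← α.map_b i]
      exact hlink _ _ _ hi hi')
    (congrArg Subtype.val α.pt_zero) h1 (hα.trans_le (min_le_right _ _))
  rw [α.pt_last] at this
  linarith

/-- A point of the closure of `Ω` that is a limit of points of a sublevel set `{φ < c}`, `c < 0`,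
of a function tending to `0` at the boundary, belongs to `Ω`. -/
theorem mem_of_tendsto_of_lt {X : Type*} [TopologicalSpace X] {Ω : Opens X} {φ : X → EReal}
    (hbdry : ∀ ξ ∈ frontier (Ω : Set X), Tendsto φ (𝓝[(Ω : Set X)] ξ) (𝓝 0)) {c : ℝ} (hc : c < 0)
    {ι : Type*} {l : Filter ι} [l.NeBot] {x : ι → X} {ξ : X} (hx : Tendsto x l (𝓝 ξ))
    (hxc : ∀ᶠ k in l, x k ∈ Ω ∧ φ (x k) < (c : EReal)) : ξ ∈ Ω := by
  by_contra hξ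
  have hcl : ξ ∈ closure (Ω : Set X) := mem_closure_of_tendsto hx (hxc.mono fun k hk => hk.1)
  have hfr : ξ ∈ frontier (Ω : Set X) := by
    rw [Ω.isOpen.frontier_eq]; exact ⟨hcl, hξ⟩
  have h1 : Tendsto (fun k => φ (x k)) l (𝓝 0) := (hbdry ξ hfr).comp
    (tendsto_nhdsWithin_iff.2 ⟨hx, hxc.mono fun k hk => hk.1⟩)
  have h2 : (0 : EReal) ≤ c := le_of_tendsto h1 (hxc.mono fun k hk => hk.2.le)
  rw [← EReal.coe_zero, EReal.coe_le_coe_iff] at h2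
  linarith

theorem HasSVP.hasQSVP_sublevel {φ : X → EReal} (h : HasSVP.{v} X Ω)
    (hbdry : ∀ ξ ∈ frontier (Ω : Set X), Tendsto φ (𝓝[(Ω : Set X)] ξ) (𝓝 0)) {c : ℝ}
    (hc : c < 0) : HasQSVP.{v} X {z : X | z ∈ Ω ∧ φ z < (c : EReal)} := by
  intro E _ _ _ A _ _ _ _ _ f hf hne
  obtain ⟨g, hg⟩ := h E A (fun k => (f k).codRestrict fun a => (hf k a).1) (by
    convert hne using 2
    ext a
    constructor
    · rintro ⟨x, hx⟩
      exact ⟨x, tendsto_subtype_rng.1 hx⟩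
    · rintro ⟨x, hx⟩
      exact ⟨⟨x, mem_of_tendsto_of_lt hbdry hc hx (Eventually.of_forall fun k => hf k a)⟩,
        tendsto_subtype_rng.2 hx⟩)
  refine ⟨g.toAmbient, tendsto_hol_iff.2 fun K hK U hU hKU => ?_⟩
  exact tendsto_hol_iff.1 hg K hK (Subtype.val ⁻¹' U) (hU.preimage continuous_subtype_val) hKU

end StrongVitali
end

noncomputable section

/-! ### Balls in charts -/

section ChartBalls

variable {E : Type*} [NormedAddCommGroup E] {A : Type*} [TopologicalSpace A] [ChartedSpace E A]

theorem exists_chart_ball {U : Set A} (hU : IsOpen U) {a : A} (ha : a ∈ U) :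
    ∃ R > 0, Metric.ball (chartAt E a a) (2 * R) ⊆
      (chartAt E a).target ∩ (chartAt E a).symm ⁻¹' U := by
  have h := (chartAt E a).isOpen_inter_preimage_symm hU
  obtain ⟨R, hR, hsub⟩ := Metric.isOpen_iff.1 h (chartAt E a a)
    ⟨mem_chart_target E a, by simpa [(chartAt E a).left_inv (mem_chart_source E a)] using ha⟩
  exact ⟨R / 2, by positivity, by rwa [mul_div_cancel₀ R two_ne_zero]⟩

theorem exists_mem_of_mem_closure_chart {S : Set A} {a : A} (ha : a ∈ closure S) {r : ℝ}
    (hr : 0 < r) : ∃ x ∈ S, x ∈ (chartAt E a).source ∧ ‖chartAt E a a - chartAt E a x‖ < r := by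
  have hV : (chartAt E a).source ∩ chartAt E a ⁻¹' Metric.ball (chartAt E a a) r ∈ 𝓝 a :=
    ((chartAt E a).isOpen_inter_preimage Metric.isOpen_ball).mem_nhds
      ⟨mem_chart_source E a, Metric.mem_ball_self hr⟩
  obtain ⟨x, ⟨hx1, hx2⟩, hx⟩ := mem_closure_iff_nhds.1 ha _ hV
  exact ⟨x, hx, hx1, by rw [norm_sub_rev]; exact mem_ball_iff_norm.1 hx2⟩

end ChartBalls

/-! ### The identity theorem -/

section Identity

variable {E : Type*} [NormedAddCommGroup E] [NormedSpace ℂ E]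

theorem DifferentiableOn.eqOn_zero_of_eventually_eq_zero {g : E → ℂ} {y : E} {R : ℝ}
    (hg : DifferentiableOn ℂ g (Metric.ball y R)) (h : ∀ᶠ v in 𝓝 y, g v = 0) :
    ∀ v ∈ Metric.ball y R, g v = 0 := fun v hv => by
  have hR : 0 < R := Metric.pos_of_mem_ball hv
  obtain ⟨t, b, ht, hb, rfl⟩ := exists_line_through (y := y) (v := v) hR
  have hd : DifferentiableOn ℂ (fun ζ : ℂ => g (y + ζ • b)) (Metric.ball 0 1) :=
    hg.comp (by fun_prop) fun ζ hζ => mem_ball_of_norm_lt_one hR hb hζ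
  have hcont : Tendsto (fun ζ : ℂ => y + ζ • b) (𝓝 0) (𝓝 y) := by
    have : Continuous fun ζ : ℂ => y + ζ • b := by fun_prop
    simpa using this.tendsto 0
  refine (hd.analyticOnNhd Metric.isOpen_ball).eqOn_zero_of_preconnected_of_eventuallyEq_zero
    (convex_ball _ _).isPreconnected (Metric.mem_ball_self one_pos) (hcont.eventually h) ?_
  rw [mem_ball_zero_iff, ht, div_lt_one hR]
  exact mem_ball_iff_norm.1 hv

variable {A : Type*} [TopologicalSpace A] [ChartedSpace E A]

variable [IsManifold 𝓘(ℂ, E) ω A]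

/-- The identity theorem on a connected open subset of a complex manifold. -/
theorem MDifferentiableOn.eq_zero_of_isPreconnected {U : Set A} (hU : IsOpen U)
    (hUc : IsPreconnected U) {g : A → ℂ} (hg : MDifferentiableOn 𝓘(ℂ, E) 𝓘(ℂ, ℂ) g U) {x : A}
    (hx : x ∈ U) (h : ∀ᶠ y in 𝓝 x, g y = 0) : ∀ y ∈ U, g y = 0 := by
  have hsub : U ⊆ {x | ∀ᶠ y in 𝓝 x, g y = 0} := by
    refine hUc.subset_of_closure_inter_subset isOpen_setOfPred_eventually_nhds ⟨x, hx, h⟩ ?_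
    rintro a ⟨hacl, haU⟩
    obtain ⟨R, hR, hball⟩ := exists_chart_ball (E := E) hU haU
    obtain ⟨z, hz, hzs, hza⟩ := exists_mem_of_mem_closure_chart (E := E) hacl hR
    set e := chartAt E a with he
    have hsub : Metric.ball (e z) R ⊆ Metric.ball (e a) (2 * R) := by
      refine Metric.ball_subset_ball' ?_
      rw [dist_eq_norm, norm_sub_rev]
      linarith
    have hd : DifferentiableOn ℂ (g ∘ e.symm) (Metric.ball (e z) R) :=
      (hg.differentiableOn_comp_chartAt_symm a).mono (hsub.trans hball)
    have hz0 : ∀ᶠ v in 𝓝 (e z), (g ∘ e.symm) v = 0 := by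
      have h1 : Tendsto e.symm (𝓝 (e z)) (𝓝 z) := by
        have := (e.continuousAt_symm (e.map_source hzs)).tendsto
        rwa [e.left_inv hzs] at this
      exact h1.eventually hz
    have hV : e.source ∩ e ⁻¹' Metric.ball (e z) R ∈ 𝓝 a :=
      (e.isOpen_inter_preimage Metric.isOpen_ball).mem_nhds
        ⟨mem_chart_source E a, mem_ball_iff_norm.2 hza⟩
    filter_upwards [hV] with y hy
    have := hd.eqOn_zero_of_eventually_eq_zero hz0 (e y) hy.2
    rwa [Function.comp_apply, e.left_inv hy.1] at this
  exact fun y hy => (hsub hy).self_of_nhds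

theorem closure_interior_subset_uniquenessSet (S : Set A) :
    closure (interior S) ⊆ uniquenessSet E S := by
  refine fun z hz => ⟨closure_mono interior_subset hz, fun U hU hUc hzU g hg h => ?_⟩
  obtain ⟨x, hxU, hxS⟩ := mem_closure_iff.1 hz U hU hzU
  refine hg.eq_zero_of_isPreconnected hU hUc.isPreconnected hxU ?_
  filter_upwards [hU.mem_nhds hxU, isOpen_interior.mem_nhds hxS] with y hy hyS
  exact h y ⟨hy, interior_subset hyS⟩

end Identity

/-! ### Localization in the source -/

section Local

variable {E : Type*} [NormedAddCommGroup E] [NormedSpace ℂ E]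
  {A : Type*} [TopologicalSpace A] [ChartedSpace E A]
  {F : Type*} [NormedAddCommGroup F] [NormedSpace ℂ F]
  {X : Type*} [TopologicalSpace X] [ChartedSpace F X]

theorem mem_uniquenessSet_restrict {S : Set A} {B : Opens A} {S' : Set B}
    (hS : ∀ x : B, (x : A) ∈ S → x ∈ S') {a : B} (ha : (a : A) ∈ uniquenessSet E S) :
    a ∈ uniquenessSet E S' := by
  refine ⟨?_, fun U hU hUc haU g hg h x hx => ?_⟩
  · have h1 : a ∈ closure (Subtype.val ⁻¹' S : Set B) := by
      rw [← B.isOpenEmbedding'.isOpenMap.preimage_closure_eq_closure_preimage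
        continuous_subtype_val]
      exact ha.1
    exact closure_mono (fun x hx => hS x hx) h1
  · have hext : ∀ y : B, Function.extend Subtype.val g 0 (y : A) = g y := fun y =>
      Subtype.val_injective.extend_apply g 0 y
    rw [← hext]
    refine ha.2 (Subtype.val '' U) (B.isOpenEmbedding'.isOpenMap U hU)
      (hUc.image _ continuous_subtype_val.continuousOn) (mem_image_of_mem _ haU) _ ?_ ?_ _
      (mem_image_of_mem _ hx)
    · rintro _ ⟨y, hy, rfl⟩
      refine MDifferentiableAt.mdifferentiableWithinAt ?_
      rw [← mdifferentiableAt_comp_subtypeVal_iff (x := y)]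
      simp only [hext]
      exact (hg y hy).mdifferentiableAt (hU.mem_nhds hy)
    · rintro _ ⟨⟨y, hy, rfl⟩, hyS⟩
      rw [hext]
      exact h y ⟨hy, hS y hyS⟩

/-- Convergence of holomorphic maps is a local property of the source. -/
theorem holConverges_of_locally [T2Space A] [T2Space X] {f : ℕ → Hol E A F X}
    (h : ∀ a : A, ∃ B : Opens A, a ∈ B ∧ ∃ g : Hol E B F X,
      Tendsto (fun k => (f k).restrict B) atTop (𝓝 g)) : HolConverges f := by
  choose B haB g hg using h
  let G : A → X := fun a => (g a).1 ⟨a, haB a⟩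
  have hG : ∀ a, (fun y : B a => G y) = (g a).1 := fun a => funext fun y =>
    tendsto_nhds_unique (tendsto_apply_of_tendsto_hol (hg y) ⟨y, haB y⟩)
      (tendsto_apply_of_tendsto_hol (hg a) y)
  have hGd : MDifferentiable 𝓘(ℂ, E) 𝓘(ℂ, F) G := fun a => by
    rw [← mdifferentiableAt_comp_subtypeVal_iff (x := (⟨a, haB a⟩ : B a)), hG a]
    exact (g a).2 _
  refine ⟨⟨⟨G, hGd.continuous⟩, hGd⟩, tendsto_hol_iff.2 fun K hK U hU hKU => ?_⟩
  have : CompactSpace K := isCompact_iff_compactSpace.1 hK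
  refine hK.induction_on (p := fun s => ∀ᶠ k in atTop, MapsTo (f k).1 s U)
    (Eventually.of_forall fun k => mapsTo_empty _ _)
    (fun s t hst ht => ht.mono fun k hk => hk.mono_left hst)
    (fun s t hs ht => by filter_upwards [hs, ht] with k h1 h2 using h1.union h2) fun a ha => ?_
  -- `A` need not be locally compact, but the compact Hausdorff space `K` is; small compact
  -- neighbourhoods are taken inside `K`.
  have hnhds : (Subtype.val ⁻¹' (B a : Set A) : Set K) ∈ 𝓝 (⟨a, ha⟩ : K) :=
    continuous_subtype_val.continuousAt.preimage_mem_nhds ((B a).isOpen.mem_nhds (haB a))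
  obtain ⟨s, hs, hsB, hsc⟩ := local_compact_nhds hnhds
  refine ⟨Subtype.val '' s, ?_, ?_⟩
  · rw [nhdsWithin_eq_map_subtype_coe ha]
    exact image_mem_map hs
  · have hc : IsCompact (Subtype.val ⁻¹' (Subtype.val '' s) : Set (B a)) := by
      rw [Topology.IsInducing.subtypeVal.isCompact_preimage_iff]
      · exact hsc.image continuous_subtype_val
      · rintro _ ⟨y, hy, rfl⟩
        exact ⟨⟨y, hsB hy⟩, rfl⟩
    have hmaps : MapsTo (g a).1 (Subtype.val ⁻¹' (Subtype.val '' s) : Set (B a)) U := by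
      rintro x ⟨y, -, hyx⟩
      rw [← hG a]
      exact hKU (hyx ▸ y.2)
    filter_upwards [tendsto_hol_iff.1 (hg a) _ hc U hU hmaps] with k hk
    rintro _ ⟨y, hy, rfl⟩
    exact hk (x := ⟨y, hsB hy⟩) (mem_image_of_mem _ hy)

end Local

/-! ### From hyperbolicity and QSVP to SVP -/

section Converse

variable {X : Type u} [NormedAddCommGroup X] [NormedSpace ℂ X] {Ω : Opens X}

theorem exists_local_limit [CompleteSpace X] {φ : X → EReal}
    (hpsh : IsPlurisubharmonicOn φ (Ω : Set X)) (hneg : ∀ z ∈ Ω, φ z < 0)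
    (hbdry : ∀ ξ ∈ frontier (Ω : Set X), Tendsto φ (𝓝[(Ω : Set X)] ξ) (𝓝 0))
    (hhyp : IsHyperbolic X Ω)
    (hQ : ∀ c : ℝ, c < 0 → HasQSVP.{v} X {z : X | z ∈ Ω ∧ φ z < (c : EReal)})
    {E : Type v} [NormedAddCommGroup E] [NormedSpace ℂ E] [CompleteSpace E]
    {A : Type v} [TopologicalSpace A] [T2Space A] [ChartedSpace E A] [IsManifold 𝓘(ℂ, E) ω A]
    {f : ℕ → Hol E A X Ω} {a : A} (ha : a ∈ uniquenessSet E (convSet f)) :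
    ∃ B : Opens A, a ∈ B ∧ ∃ g : Hol E B X Ω,
      Tendsto (fun k => (f k).restrict B) atTop (𝓝 g) := by
  obtain ⟨R, hR, hball⟩ := exists_chart_ball (E := E) isOpen_univ (mem_univ a)
  -- `a` itself need not be a point of convergence. The radius `R / 4` puts `a` in the ball about
  -- `y` that corresponds to `‖ζ‖ ≤ 1 / 4` in the two-constants estimate.
  obtain ⟨x, ⟨q, hq⟩, hxs, hxa⟩ := exists_mem_of_mem_closure_chart (E := E) ha.1
    (show 0 < R / 4 by positivity)
  set e := chartAt E a with he
  set y := e x with hy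
  have hyR : Metric.ball y R ⊆ e.target := fun v hv => (hball (Metric.ball_subset_ball' (by
    rw [dist_eq_norm, norm_sub_rev]; linarith) hv)).1
  let G : ℕ → E → X := fun k v => (f k).1 (e.symm v)
  have hGd : ∀ k, DifferentiableOn ℂ (G k) (Metric.ball y R) := fun k =>
    ((f k).toAmbient.2.mdifferentiableOn (s := univ)).differentiableOn_comp_chartAt_symm a
      |>.mono fun v hv => ⟨hyR hv, mem_univ _⟩
  have hGΩ : ∀ k, MapsTo (G k) (Metric.ball y R) Ω := fun k v _ => ((f k).1 (e.symm v)).2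
  obtain ⟨c, hqc, hc⟩ := EReal.lt_iff_exists_real_btwn.1 (hneg q q.2)
  rw [← EReal.coe_zero, EReal.coe_lt_coe_iff] at hc
  obtain ⟨δ, hδ, hδG⟩ := hhyp.exists_mapsTo.{u, v}
    (hpsh.isOpen_lt Ω.isOpen (c : EReal)) (q := q) ⟨q.2, hqc⟩
  obtain ⟨c', hc', hconst⟩ := hpsh.exists_two_constants Ω.isOpen hneg
    (show 0 < min δ 1 by positivity) hc
  have hGy : ∀ k, G k y = (f k).1 x := fun k => by simp only [G, hy, e.left_inv hxs]
  have hev : ∀ᶠ k in atTop, ‖G k y - q‖ < δ := by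
    have h1 : Tendsto (fun k => ((f k).1 x : X)) atTop (𝓝 q) := tendsto_subtype_rng.1 hq
    filter_upwards [h1 (Metric.ball_mem_nhds _ hδ)] with k hk
    rw [hGy]
    exact mem_ball_iff_norm.1 hk
  have hsmall : ∀ k, ‖G k y - q‖ < δ → ∀ v ∈ Metric.ball y (R / 4), φ (G k v) < (c' : EReal) := by
    intro k hk v hv
    obtain ⟨t, b, ht, hb, rfl⟩ := exists_line_through (y := y) (v := v) hR
    have hm : MapsTo (fun ζ : ℂ => y + ζ • b) (Metric.ball 0 1) (Metric.ball y R) :=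
      fun ζ hζ => mem_ball_of_norm_lt_one hR hb hζ
    refine hconst (fun ζ => G k (y + ζ • b)) ((hGd k).comp (by fun_prop) hm)
      (fun ζ hζ => hGΩ k (hm hζ)) (fun ζ hζ => ?_) t ?_
    · rw [lt_min_iff] at hζ
      refine (hδG (hGd k) (hGΩ k) (hm (mem_ball_zero_iff.2 hζ.2)) hk ?_).2
      rw [add_sub_cancel_left, norm_smul]
      calc ‖ζ‖ * ‖b‖ ≤ ‖ζ‖ * R := by gcongr
        _ < δ * R := by gcongr; exact hζ.1
    · rw [ht, div_le_iff₀ hR]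
      linarith [mem_ball_iff_norm.1 hv]
  obtain ⟨k₀, hk₀⟩ := eventually_atTop.1 hev
  let B : Opens A := ⟨e.source ∩ e ⁻¹' Metric.ball y (R / 4),
    e.isOpen_inter_preimage Metric.isOpen_ball⟩
  have haB : a ∈ B := ⟨mem_chart_source E a, mem_ball_iff_norm.2 hxa⟩
  have hBc : IsConnected (B : Set A) := by
    have hsub : Metric.ball y (R / 4) ⊆ e.target :=
      (Metric.ball_subset_ball (by linarith)).trans hyR
    change IsConnected (e.source ∩ e ⁻¹' Metric.ball y (R / 4))
    rw [← e.symm_image_eq_source_inter_preimage hsub]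
    exact ((convex_ball y (R / 4)).isConnected ⟨y, Metric.mem_ball_self (by positivity)⟩).image _
      (e.continuousOn_symm.mono hsub)
  have : ConnectedSpace B := isConnected_iff_connectedSpace.1 hBc
  -- QSVP requires every term to lie in the sublevel set, so the first `k₀` terms are dropped.
  let h : ℕ → Hol E B X X := fun k => ((f (k + k₀)).toAmbient).restrict B
  have hh : ∀ k z, (h k).1 z ∈ {z : X | z ∈ Ω ∧ φ z < (c' : EReal)} := fun k z => by
    refine ⟨((f (k + k₀)).1 z).2, ?_⟩
    have := hsmall (k + k₀) (hk₀ _ (Nat.le_add_left _ _)) (e z) z.2.2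
    simp only [G, e.left_inv z.2.1] at this
    exact this
  obtain ⟨g, hg⟩ := hQ c' hc' E B h hh ⟨⟨a, haB⟩, mem_uniquenessSet_restrict (fun z hz => by
    obtain ⟨p, hp⟩ := hz
    exact ⟨p, (tendsto_subtype_rng.1 hp).comp (tendsto_add_atTop_nat k₀)⟩) ha⟩
  have hgΩ : ∀ z, g.1 z ∈ Ω := fun z => mem_of_tendsto_of_lt hbdry hc'
    (tendsto_apply_of_tendsto_hol hg z) (Eventually.of_forall fun k => hh k z)
  refine ⟨B, haB, g.codRestrict hgΩ, ?_⟩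
  rw [← tendsto_add_atTop_iff_nat k₀, tendsto_hol_iff]
  intro K hK U hU hKU
  filter_upwards [tendsto_hol_iff.1 hg K hK _ (Ω.isOpenEmbedding'.isOpenMap U hU)
    fun z hz => mem_image_of_mem Subtype.val (hKU hz)] with k hk z hz
  obtain ⟨p, hpU, hp⟩ := hk hz
  exact (Subtype.ext hp : p = (f (k + k₀)).1 z) ▸ hpU

theorem hasSVP_of_isHyperbolic [CompleteSpace X] {φ : X → EReal}
    (hpsh : IsPlurisubharmonicOn φ (Ω : Set X)) (hneg : ∀ z ∈ Ω, φ z < 0)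
    (hbdry : ∀ ξ ∈ frontier (Ω : Set X), Tendsto φ (𝓝[(Ω : Set X)] ξ) (𝓝 0))
    (hhyp : IsHyperbolic X Ω)
    (hQ : ∀ c : ℝ, c < 0 → HasQSVP.{v} X {z : X | z ∈ Ω ∧ φ z < (c : EReal)}) :
    HasSVP.{v} X Ω := by
  intro E _ _ _ A _ _ _ _ _ f hne
  have hsub : uniquenessSet E (convSet f) ⊆ interior (convSet f) := fun a ha => by
    obtain ⟨B, haB, g, hg⟩ := exists_local_limit hpsh hneg hbdry hhyp hQ ha
    exact mem_interior.2 ⟨B, fun z hz => ⟨g.1 ⟨z, hz⟩, tendsto_apply_of_tendsto_hol hg ⟨z, hz⟩⟩,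
      B.isOpen, haB⟩
  -- Limit points of the interior are uniqueness points by the identity theorem, hence interior
  -- again.
  have hclosed : IsClosed (interior (convSet f)) := isClosed_of_closure_subset
    ((closure_interior_subset_uniquenessSet (E := E) _).trans hsub)
  have huniv : interior (convSet f) = univ :=
    IsClopen.eq_univ ⟨hclosed, isOpen_interior⟩ (hne.mono hsub)
  refine holConverges_of_locally fun a => exists_local_limit hpsh hneg hbdry hhyp hQ ?_
  exact closure_interior_subset_uniquenessSet (E := E) _ (subset_closure (huniv ▸ mem_univ a))

end Converse
end

theorem theorem4p4 {X : Type u} [NormedAddCommGroup X] [NormedSpace ℂ X] [CompleteSpace X]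
    (Ω : Opens X) (φ : X → EReal)
    (hpsh : IsPlurisubharmonicOn φ (Ω : Set X))
    (hneg : ∀ z ∈ Ω, φ z < 0)
    (hbdry : ∀ ξ ∈ frontier (Ω : Set X), Tendsto φ (𝓝[(Ω : Set X)] ξ) (𝓝 0)) :
    (IsHyperbolic X Ω ∧
      ∀ c : ℝ, c < 0 → HasQSVP.{v} X {z : X | z ∈ Ω ∧ φ z < (c : EReal)}) ↔
    HasSVP.{v} X Ω :=
  ⟨fun h => hasSVP_of_isHyperbolic hpsh hneg hbdry h.1 h.2,
    fun h => ⟨h.isHyperbolic, fun _ hc => h.hasQSVP_sublevel hbdry hc⟩⟩
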